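/- Let $\mathcal U=\mathbb Z\langle u_1,\dots,u_8\rangle$ be the free associative ring; its monomials are identified with words in the letters $1,\dots,8$, and $\langle\cdot,\cdot\rangle$ is the symmetric bilinear form for which the words are orthonormal. Let $I$ be the two-sided ideal of $\mathcal U$ generated by the elements $b(ac-ca)-(ac-ca)b$ for letters $a<b<c$ and by all words with a repeated letter, and let $I^\perp=\{f\in\mathcal U : \langle z,f\rangle=0 \text{ for all } z\in I\}$. Put $e_d(\mathbf u)=\sum_{i_1>\cdots>i_d}u_{i_1}\cdots u_{i_d}$ (with $e_0=1$, and $e_d=0$ for $d<0$), and for a partition $\lambda$ with conjugate $\lambda'=(\lambda'_1,\dots,\lambda'_t)$ let $$\mathfrak J_\lambda(\mathbf u)=\sum_{\pi\in\mathcal S_t}\operatorname{sgn}(\pi)\,e_{\lambda'_1+\pi(1)-1}(\mathbf u)\cdots e_{\lambda'_t+\pi(t)-t}(\mathbf u).$$ Let $\Delta$ be the $\mathbb Z$-linear map on $\mathcal U$ sending a word $w$ to Gessel's fundamental quasisymmetric function $Q_{\mathrm{Des}(w)}(\mathbf x)$, $\mathrm{Des}(w)=\{i: w_i>w_{i+1}\}$.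 A power series is called Schur positive if it is a finite nonnegative integer combination of Schur functions. A D$_0$ graph of degree $n$ is a graph on a set $W$ of words of length $n$ with no repeated letter, with edges coloured from $\{2,\dots,n-1\}$, such that (i) each $i$-edge is one of the pairs $\{v\,bac\,w, v\,bca\,w\}$, $\{v\,acb\,w, v\,cab\,w\}$, $\{v\,bac\,w, v\,acb\,w\}$, $\{v\,bca\,w, v\,cab\,w\}$ for some letters $a<b<c$ and words $v,w$ with $v$ of length $i-2$; and (ii) for all such $a<b<c$, $v$, $w$, each element of $W\cap\{v\,bac\,w, v\,bca\,w, v\,acb\,w, v\,cab\,w\}$ belongs to exactly one $i$-edge. Its generating function is $\sum_{w\in W}Q_{\mathrm{Des}(w)}(\mathbf x)$. For $w\in\mathcal S_8$ (written as a word) let $P(w)$ be its Schensted (row) insertion tableau, and let $\mathrm{inv}_k(w)$ be the number of pairs $i<j$ with $0<w_i-w_j<k$. For a $k$-tuple $\beta=(\beta^{(0)},\dots,\beta^{(k-1)})$ of skew shapes (drawn in the English convention, rows numbered downwards), the shifted content of the cell in row $r$ and column $s$ of $\beta^{(i)}$ is $k(s-r)+i$, and $\mathsf W_k(\beta)$ is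 the set of words with no repeated letter that are rearrangements of the shifted contents of $\beta$ and in which, whenever $z'$ is a cell of some $\beta^{(i)}$ immediately east or south of a cell $z$ of $\beta^{(i)}$, the shifted content of $z$ occurs before that of $z'$. Let $W^*\subseteq\mathcal S_8$ be the union of - $\{w\in\mathcal S_8 : P(w)\text{ has shape }(2,2,2,2)\text{ and } P(w)\text{ is not the tableau with rows }12,\,34,\,56,\,78\}$, - $\{w\in\mathcal S_8 : w\in\mathsf W_3(\beta_3),\ \mathrm{inv}_3(w)=9\}$, where $\beta_3=(33,333,333)/(22,222,222)$, - $\{w\in\mathcal S_8 : w\in\mathsf W_7(\beta_7),\ \mathrm{inv}_7(w)=18\}$, where $\beta_7=(2,2,1,1,1,1,1)/(1,\varnothing,\varnothing,\varnothing,\varnothing,\varnothing,\varnothing)$, and let $\bar W^*=\mathcal S_8\setminus W^*$ and $f^*=\sum_{w\in\bar W^*}w\in\mathcal U$. Then $f^*\in I^\perp$ and $\langle\mathfrak J_{(2,2,2,2)}(\mathbf u),f^*\rangle=-1$. The generating function $\Delta(f^*)$ is not Schur positive, and there is a D$_0$ graph with vertex set $\bar W^*$ whose generating function is not Schur positive.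 -/

import Mathlib

noncomputable section

namespace DZero

/-! ### Words and the free associative algebra

A word in the alphabet `{1, …, N}` is a list over `Fin N`; the element `a : Fin N` stands for the
letter `a + 1`. -/

/-- The words with no repeated letter, of length `n`. -/
def IsStdWord {N : ℕ} (n : ℕ) (w : List (Fin N)) : Prop := w.length = n ∧ w.Nodup

/-- The permutations of `N` in one-line notation, as words. -/
def permWords (N : ℕ) : Finset (List (Fin N)) :=
  (Finset.univ : Finset (Equiv.Perm (Fin N))).image fun σ => List.ofFn fun i => σ i

/-- The free associative ring `ℤ⟨u_1, …, u_N⟩`, with basis the words. -/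
abbrev U (N : ℕ) : Type := MonoidAlgebra ℤ (FreeMonoid (Fin N))

/-- A word, as a monomial. -/
def mono {N : ℕ} (w : List (Fin N)) : U N := MonoidAlgebra.single (FreeMonoid.ofList w) 1

/-- A single variable. -/
def var {N : ℕ} (a : Fin N) : U N := mono [a]

/-- The sum of the words in a finite set of words. -/
def wordSum {N : ℕ} (W : Finset (List (Fin N))) : U N := ∑ w ∈ W, mono w

/-- The bilinear form on `U N` for which the words are orthonormal. -/
def pairing {N : ℕ} (f g : U N) : ℤ := f.coeff.sum fun w c => c * g.coeff w

/-- The orthogonal complement of a two-sided ideal. -/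
def perp {N : ℕ} (I : TwoSidedIdeal (U N)) : Set (U N) := {f | ∀ z ∈ I, pairing z f = 0}

/-- The two-sided ideal generated by the elements `b(ac - ca) - (ac - ca)b` for letters `a < b < c`
and by the words with a repeated letter. -/
def idealKR (N : ℕ) : TwoSidedIdeal (U N) :=
  TwoSidedIdeal.span
    ({z | ∃ a b c : Fin N, a < b ∧ b < c ∧
        z = var b * (var a * var c - var c * var a) - (var a * var c - var c * var a) * var b} ∪
      {z | ∃ w : List (Fin N), ¬ w.Nodup ∧ z = mono w})

/-! ### Noncommutative elementary symmetric and Schur functions -/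

/-- The noncommutative elementary symmetric function: the sum of all strictly decreasing words of
length `d`; it is `0` for `d < 0` (and `1` for `d = 0`). -/
def ncElem (N : ℕ) (d : ℤ) : U N :=
  if d < 0 then 0
  else ∑ S ∈ (Finset.univ : Finset (Fin N)).powersetCard d.toNat, mono (S.sort (· ≥ ·))

/-- The noncommutative Schur function, by the Jacobi–Trudi formula in the column lengths of `μ`
(the product is taken from left to right). -/
def ncSchur (N : ℕ) (μ : YoungDiagram) : U N :=
  ∑ π : Equiv.Perm (Fin (μ.rowLen 0)),
    (Equiv.Perm.sign π : ℤ) •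
      (List.ofFn fun i : Fin (μ.rowLen 0) =>
        ncElem N ((μ.colLen i : ℤ) + ((π i : ℕ) : ℤ) - ((i : ℕ) : ℤ))).prod

/-! ### Generating functions

Formal power series over `ℤ` in variables indexed by `ℕ`. -/

/-- The descents of a word, with positions counted from `0`. -/
def descents {N : ℕ} (w : List (Fin N)) : Set ℕ :=
  {j | ∃ h : j + 1 < w.length, w[j + 1] < w[j]}

/-- Gessel's fundamental quasisymmetric function of degree `n`: the sum of the monomials
`x_{s 0} ⋯ x_{s (n-1)}` over the weakly increasing `s` that increase strictly at `D`. -/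
def fundQuasi (n : ℕ) (D : Set ℕ) : MvPowerSeries ℕ ℤ := fun m =>
  (Nat.card {s : Fin n → ℕ // Monotone s ∧
    (∀ (j : ℕ) (h : j + 1 < n), j ∈ D → s ⟨j, Nat.lt_of_succ_lt h⟩ < s ⟨j + 1, h⟩) ∧
    ∑ j, Finsupp.single (s j) 1 = m} : ℤ)

/-- The linear map sending a word to the fundamental quasisymmetric function of its descent set. -/
def Delta (N : ℕ) : U N →ₗ[ℤ] MvPowerSeries ℕ ℤ :=
  (Finsupp.linearCombination ℤ fun w : FreeMonoid (Fin N) =>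
      fundQuasi w.toList.length (descents w.toList)) ∘ₗ
    (MonoidAlgebra.coeffLinearEquiv ℤ).toLinearMap

/-- The Schur function `s_μ`, the generating function of semistandard tableaux of shape `μ`. -/
def schur (μ : YoungDiagram) : MvPowerSeries ℕ ℤ := fun m =>
  (Nat.card {T : SemistandardYoungTableau μ //
    ∑ z ∈ μ.cells, Finsupp.single (T z.1 z.2) 1 = m} : ℤ)

/-- A nonnegative integer combination of Schur functions. -/
def SchurPositive (F : MvPowerSeries ℕ ℤ) : Prop :=
  ∃ c : YoungDiagram →₀ ℕ, F = c.sum fun μ k => (k : ℤ) • schur μ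

/-! ### D₀ graphs -/

/-- `{x, y}` is one of the four pairs `{v bac w, v bca w}`, `{v acb w, v cab w}` (Knuth),
`{v bac w, v acb w}`, `{v bca w, v cab w}` (rotation), in this order of `x` and `y`, for given
letters `a, b, c` and words `v, w`. -/
def IsKRPair {N : ℕ} (v w : List (Fin N)) (a b c : Fin N) (x y : List (Fin N)) : Prop :=
  (x = v ++ [b, a, c] ++ w ∧ y = v ++ [b, c, a] ++ w) ∨
  (x = v ++ [a, c, b] ++ w ∧ y = v ++ [c, a, b] ++ w) ∨
  (x = v ++ [b, a, c] ++ w ∧ y = v ++ [a, c, b] ++ w) ∨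
  (x = v ++ [b, c, a] ++ w ∧ y = v ++ [c, a, b] ++ w)

/-- The set `{v bac w, v bca w, v acb w, v cab w}`. -/
def krSquare {N : ℕ} (v w : List (Fin N)) (a b c : Fin N) : Set (List (Fin N)) :=
  {v ++ [b, a, c] ++ w, v ++ [b, c, a] ++ w, v ++ [a, c, b] ++ w, v ++ [c, a, b] ++ w}

/-- A D₀ graph of degree `n` on words in the alphabet `{1, …, N}`. The `i`-edges are the edges of
the graph `edge i` (a pair of words may be an edge of several colours). -/
structure D0Graph (N n : ℕ) where
  /-- The vertex set. -/
  verts : Finset (List (Fin N))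
  verts_std : ∀ w ∈ verts, IsStdWord n w
  /-- The edges of each colour. -/
  edge : ℕ → SimpleGraph (List (Fin N))
  edge_mem : ∀ i x y, (edge i).Adj x y → x ∈ verts ∧ y ∈ verts
  edge_color : ∀ i x y, (edge i).Adj x y → 2 ≤ i ∧ i ≤ n - 1
  edge_type : ∀ i x y, (edge i).Adj x y →
    ∃ (v w : List (Fin N)) (a b c : Fin N), v.length + 2 = i ∧ a < b ∧ b < c ∧
      (IsKRPair v w a b c x y ∨ IsKRPair v w a b c y x)
  edge_unique : ∀ (v w : List (Fin N)) (a b c : Fin N), a < b → b < c →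
    ∀ x ∈ verts, x ∈ krSquare v w a b c → ∃! y, (edge (v.length + 2)).Adj x y

/-- The generating function of a D₀ graph. -/
def D0Graph.genFun {N n : ℕ} (G : D0Graph N n) : MvPowerSeries ℕ ℤ :=
  ∑ w ∈ G.verts, fundQuasi n (descents w)

/-! ### Insertion tableaux -/

/-- Row insertion of `x` into a row: `x` replaces the leftmost entry that is larger than `x`, which
is bumped out, or is added at the end of the row if there is no such entry. -/
def rowInsert {N : ℕ} (x : Fin N) : List (Fin N) → List (Fin N) × Option (Fin N)
  | [] => ([x], none)
  | y :: r => if x < y then (x :: r, some y) else (y :: (rowInsert x r).1, (rowInsert x r).2)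

/-- Schensted insertion of `x` into a tableau given by the list of its rows. -/
def tabInsert {N : ℕ} (x : Fin N) : List (List (Fin N)) → List (List (Fin N))
  | [] => [[x]]
  | r :: T =>
    match rowInsert x r with
    | (r', none) => r' :: T
    | (r', some y) => r' :: tabInsert y T

/-- The insertion tableau `P(w)`, as the list of its rows. -/
def insTab {N : ℕ} (w : List (Fin N)) : List (List (Fin N)) :=
  w.foldl (fun T x => tabInsert x T) []

/-! ### LLT equivalence classes -/

/-- A skew shape `outer / inner`. -/
structure SkewShape where
  outer : YoungDiagram
  inner : YoungDiagram
  inner_le : inner ≤ outer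

/-- The cells `(row, column)` of a skew shape (matrix convention, counted from `0`). -/
def SkewShape.cells (s : SkewShape) : Finset (ℕ × ℕ) := s.outer.cells \ s.inner.cells

/-- The shifted content `k (column - row) + i` of a cell of the `i`-th shape in a `k`-tuple. -/
def shiftedContent (k i : ℕ) (z : ℕ × ℕ) : ℤ := k * ((z.2 : ℤ) - z.1) + i

/-- The integer represented by a letter. -/
def letterVal {N : ℕ} (a : Fin N) : ℤ := (a : ℕ) + 1

/-- The integer `p` occurs before the integer `q` in the word `v`. -/
def OccursBefore {N : ℕ} (v : List (Fin N)) (p q : ℤ) : Prop :=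
  ∃ i j : Fin v.length, i < j ∧ letterVal v[i] = p ∧ letterVal v[j] = q

/-- The words with no repeated letter that are rearrangements of the shifted contents of the tuple
`β`, and in which the shifted content of a cell occurs before that of the cell of the same shape
immediately east or immediately south of it. -/
def lltWords (N : ℕ) {k : ℕ} (β : Fin k → SkewShape) : Set (List (Fin N)) :=
  {v | v.Nodup ∧
    (v : Multiset (Fin N)).map letterVal =
      ∑ i : Fin k, (β i).cells.val.map (shiftedContent k i) ∧
    ∀ (i : Fin k), ∀ z ∈ (β i).cells, ∀ z' ∈ (β i).cells,
      (z' = (z.1, z.2 + 1) ∨ z' = (z.1 + 1, z.2)) →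
        OccursBefore v (shiftedContent k i z) (shiftedContent k i z')}

/-- The `k`-inversion number: the number of pairs of positions `i < j` with `0 < v_i - v_j < k`. -/
def kInv {N : ℕ} (k : ℕ) (v : List (Fin N)) : ℕ :=
  (Finset.univ.filter fun p : Fin v.length × Fin v.length =>
    p.1 < p.2 ∧ 0 < letterVal v[p.1] - letterVal v[p.2] ∧
      letterVal v[p.1] - letterVal v[p.2] < k).card

/-! ### The set `W̄*` -/

/-- The partition `(2,2,2,2)`. -/
def shape2222 : YoungDiagram := YoungDiagram.ofRowLens [2, 2, 2, 2] (by decide)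

/-- The skew shape `l / m` of two partitions given by the lists of their parts. -/
def skewOf (l m : List ℕ) (hl : l.SortedGE) (hm : m.SortedGE)
    (h : (YoungDiagram.ofRowLens m hm).cells ⊆ (YoungDiagram.ofRowLens l hl).cells) : SkewShape :=
  ⟨YoungDiagram.ofRowLens l hl, YoungDiagram.ofRowLens m hm, h⟩

/-- `(33, 333, 333) / (22, 222, 222)`. -/
def beta3 : Fin 3 → SkewShape :=
  ![skewOf [3, 3] [2, 2] (by decide) (by decide) (by decide),
    skewOf [3, 3, 3] [2, 2, 2] (by decide) (by decide) (by decide),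
    skewOf [3, 3, 3] [2, 2, 2] (by decide) (by decide) (by decide)]

/-- `(2, 2, 1, 1, 1, 1, 1) / (1, ∅, ∅, ∅, ∅, ∅, ∅)`. -/
def beta7 : Fin 7 → SkewShape :=
  ![skewOf [2] [1] (by decide) (by decide) (by decide),
    skewOf [2] [] (by decide) (by decide) (by decide),
    skewOf [1] [] (by decide) (by decide) (by decide),
    skewOf [1] [] (by decide) (by decide) (by decide),
    skewOf [1] [] (by decide) (by decide) (by decide),
    skewOf [1] [] (by decide) (by decide) (by decide),
    skewOf [1] [] (by decide) (by decide) (by decide)]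

open Classical in
/-- The union of the 13 Knuth classes of shape `(2,2,2,2)` in `S_8` whose insertion tableau is not
the one with rows `12, 34, 56, 78`. -/
def knuthPart : Finset (List (Fin 8)) :=
  (permWords 8).filter fun w =>
    (insTab w).map List.length = [2, 2, 2, 2] ∧ insTab w ≠ [[0, 1], [2, 3], [4, 5], [6, 7]]

open Classical in
/-- The LLT equivalence class for `k = 3`. -/
def lltPart3 : Finset (List (Fin 8)) :=
  (permWords 8).filter fun w => w ∈ lltWords 8 beta3 ∧ kInv 3 w = 9

open Classical in
/-- The LLT equivalence class for `k = 7`. -/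
def lltPart7 : Finset (List (Fin 8)) :=
  (permWords 8).filter fun w => w ∈ lltWords 8 beta7 ∧ kInv 7 w = 18

/-- The set `W*`. -/
def Wstar : Finset (List (Fin 8)) := knuthPart ∪ lltPart3 ∪ lltPart7

/-- The set `W̄*`, the complement of `W*` in `S_8`. -/
def Wbar : Finset (List (Fin 8)) := permWords 8 \ Wstar

/-- The element `f*`, the sum of the words in `W̄*`. -/
def fstar : U 8 := wordSum Wbar

end DZero

end

/-!
Call a set of words *balanced* if its trace on each square `{v bac t, v bca t, v acb t, v cab t}` is
a union of Knuth pairs or a union of rotation pairs. Orthogonality of `f*` to the ideal says that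
`W̄*` is balanced, and pairs of one of the two kinds in each square are the edges of a D₀ graph.
A set defined by a condition on the insertion tableau is always a union of Knuth pairs. The LLT
words with a given `k`-inversion number form a union of Knuth pairs in the squares with `c - a > k`,
and of rotation pairs in the others. Disjoint unions and complements of balanced sets are balanced,
and the three parts of `W*` are disjoint.

The Jacobi–Trudi formula gives `𝔍_(2,2,2,2) = e₄ e₄ - e₅ e₃`. The pairing of `e_d e_(8-d)` with `f*`
is the number of words in `W̄*` that decrease except perhaps after the first `d` letters, and this
number is `51` for `d = 4` and `52` for `d = 5`.

The number of such words is also a linear function of `Δ(f*)`, since it only depends on descent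
sets. At a Schur function `s_μ` this linear function counts the standard tableaux of shape `μ` with
no ascent except perhaps at `d`. There is at most one, since it must fill the top `d` cells of the
first column and then the columns from right to left. If it exists for `d = 5` and `μ` has `8`
cells, then `μ` has at most two columns, the second of length at most `4`, and it also exists for
`d = 4`. Hence a Schur positive function cannot have the counts `51` and `52`.
-/

noncomputable section

namespace DZero

variable {N : ℕ}

theorem mem_permWords {w : List (Fin N)} : w ∈ permWords N ↔ IsStdWord N w := by
  simp only [permWords, IsStdWord, Finset.mem_image, Finset.mem_univ, true_and]
  constructor
  · rintro ⟨σ, rfl⟩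
    exact ⟨List.length_ofFn, List.nodup_ofFn_ofInjective σ.injective⟩
  · rintro ⟨hl, hn⟩
    have hinj : Function.Injective fun i : Fin N => w[i] := fun i j hij =>
      Fin.ext ((hn.getElem_inj_iff).1 hij)
    exact ⟨Equiv.ofBijective _ (Finite.injective_iff_bijective.1 hinj),
      List.ext_getElem (by simp [hl]) (by simp)⟩

theorem mem_permWords_iff_of_perm {w w' : List (Fin N)} (h : w.Perm w') :
    w ∈ permWords N ↔ w' ∈ permWords N := by
  rw [mem_permWords, mem_permWords, IsStdWord, IsStdWord, h.length_eq, h.nodup_iff]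

theorem mem_of_mem_permWords {w : List (Fin N)} (hw : w ∈ permWords N) (a : Fin N) : a ∈ w := by
  obtain ⟨σ, -, rfl⟩ := Finset.mem_image.1 hw
  exact (List.mem_ofFn' _ _).2 (σ.surjective a)

/-! ### Balanced sets of words -/

section Balanced

/-- `x, y` is one of the two Knuth pairs of a square `krSquare`, in this order. -/
def IsKnuthPair (v t : List (Fin N)) (a b c : Fin N) (x y : List (Fin N)) : Prop :=
  (x = v ++ [b, a, c] ++ t ∧ y = v ++ [b, c, a] ++ t) ∨
  (x = v ++ [a, c, b] ++ t ∧ y = v ++ [c, a, b] ++ t)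

/-- `x, y` is one of the two rotation pairs of a square `krSquare`, in this order. -/
def IsRotationPair (v t : List (Fin N)) (a b c : Fin N) (x y : List (Fin N)) : Prop :=
  (x = v ++ [b, a, c] ++ t ∧ y = v ++ [a, c, b] ++ t) ∨
  (x = v ++ [b, c, a] ++ t ∧ y = v ++ [c, a, b] ++ t)

/-- Within the square given by `v, t, a, b, c`, the set `W` is a union of Knuth pairs. -/
def KnuthClosed (W : Set (List (Fin N))) (v t : List (Fin N)) (a b c : Fin N) : Prop :=
  ∀ x y, IsKnuthPair v t a b c x y → (x ∈ W ↔ y ∈ W)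

/-- Within the square given by `v, t, a, b, c`, the set `W` is a union of rotation pairs. -/
def RotationClosed (W : Set (List (Fin N))) (v t : List (Fin N)) (a b c : Fin N) : Prop :=
  ∀ x y, IsRotationPair v t a b c x y → (x ∈ W ↔ y ∈ W)

/-- A set of words is balanced if each `krSquare` contains as many of its elements among
`v bac t` and `v cab t` as among `v bca t` and `v acb t`. On sets of standard words this amounts to
orthogonality to `idealKR`. -/
def Balanced (W : Set (List (Fin N))) : Prop :=
  ∀ (v t : List (Fin N)) (a b c : Fin N), a < b → b < c →
    W.indicator (1 : List (Fin N) → ℤ) (v ++ [b, a, c] ++ t) +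
        W.indicator 1 (v ++ [c, a, b] ++ t) =
      W.indicator 1 (v ++ [b, c, a] ++ t) + W.indicator 1 (v ++ [a, c, b] ++ t)

variable {V W : Set (List (Fin N))} {v t : List (Fin N)} {a b c : Fin N}

theorem knuthClosed_iff : KnuthClosed W v t a b c ↔
    (v ++ [b, a, c] ++ t ∈ W ↔ v ++ [b, c, a] ++ t ∈ W) ∧
      (v ++ [a, c, b] ++ t ∈ W ↔ v ++ [c, a, b] ++ t ∈ W) := by
  refine ⟨fun h => ⟨h _ _ (.inl ⟨rfl, rfl⟩), h _ _ (.inr ⟨rfl, rfl⟩)⟩, ?_⟩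
  rintro ⟨h₁, h₂⟩ x y (⟨rfl, rfl⟩ | ⟨rfl, rfl⟩) <;> assumption

theorem rotationClosed_iff : RotationClosed W v t a b c ↔
    (v ++ [b, a, c] ++ t ∈ W ↔ v ++ [a, c, b] ++ t ∈ W) ∧
      (v ++ [b, c, a] ++ t ∈ W ↔ v ++ [c, a, b] ++ t ∈ W) := by
  refine ⟨fun h => ⟨h _ _ (.inl ⟨rfl, rfl⟩), h _ _ (.inr ⟨rfl, rfl⟩)⟩, ?_⟩
  rintro ⟨h₁, h₂⟩ x y (⟨rfl, rfl⟩ | ⟨rfl, rfl⟩) <;> assumption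

theorem balanced_iff_knuthClosed_or_rotationClosed :
    Balanced W ↔ ∀ (v t : List (Fin N)) (a b c : Fin N), a < b → b < c →
      KnuthClosed W v t a b c ∨ RotationClosed W v t a b c := by
  classical
  refine forall₅_congr fun v t a b c => forall₂_congr fun _ _ => ?_
  simp only [knuthClosed_iff, rotationClosed_iff, Set.indicator_apply, Pi.one_apply]
  split_ifs <;> simp_all

theorem Balanced.union (hV : Balanced V) (hW : Balanced W) (hVW : Disjoint V W) :
    Balanced (V ∪ W) := fun v t a b c hab hbc => by
  simp only [Set.indicator_union_of_disjoint hVW]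
  linear_combination hV v t a b c hab hbc + hW v t a b c hab hbc

theorem Balanced.diff (hW : Balanced W) (hV : Balanced V) (hVW : V ⊆ W) :
    Balanced (W \ V) := fun v t a b c hab hbc => by
  rw [Set.indicator_sdiff hVW]
  simp only [Pi.sub_apply]
  linear_combination hW v t a b c hab hbc - hV v t a b c hab hbc

theorem perm_of_isKnuthPair {x y : List (Fin N)} (h : IsKnuthPair v t a b c x y) : x.Perm y := by
  rcases h with ⟨rfl, rfl⟩ | ⟨rfl, rfl⟩
  · exact (((List.Perm.swap c a []).cons b).append_left v).append_right t
  · exact ((List.Perm.swap c a [b]).append_left v).append_right t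

theorem perm_of_isRotationPair {x y : List (Fin N)} (h : IsRotationPair v t a b c x y) :
    x.Perm y := by
  rcases h with ⟨rfl, rfl⟩ | ⟨rfl, rfl⟩
  · exact ((List.perm_append_comm (l₁ := [b])).append_left v).append_right t
  · exact ((List.perm_append_comm (l₁ := [b])).append_left v).append_right t

theorem balanced_permWords : Balanced (permWords N : Set (List (Fin N))) :=
  balanced_iff_knuthClosed_or_rotationClosed.2 fun _ _ _ _ _ _ _ =>
    .inl fun _ _ h => mem_permWords_iff_of_perm (perm_of_isKnuthPair h)

theorem Balanced.permWords_inter (hW : Balanced W) : Balanced ((permWords N : Set _) ∩ W) := by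
  rw [balanced_iff_knuthClosed_or_rotationClosed] at hW ⊢
  exact fun v t a b c hab hbc => (hW v t a b c hab hbc).imp
    (fun hK x y h => and_congr (mem_permWords_iff_of_perm (perm_of_isKnuthPair h)) (hK x y h))
    (fun hR x y h => and_congr (mem_permWords_iff_of_perm (perm_of_isRotationPair h)) (hR x y h))

end Balanced

/-! ### D₀ graphs from balanced sets -/

section D0Graph

variable {W : Set (List (Fin N))} {v t : List (Fin N)} {a b c : Fin N} {x y : List (Fin N)}

theorem isKRPair_iff : IsKRPair v t a b c x y ↔
    IsKnuthPair v t a b c x y ∨ IsRotationPair v t a b c x y := by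
  rw [IsKRPair, IsKnuthPair, IsRotationPair, or_assoc]

theorem IsKRPair.mem_krSquare (h : IsKRPair v t a b c x y) :
    x ∈ krSquare v t a b c ∧ y ∈ krSquare v t a b c := by
  rcases h with ⟨rfl, rfl⟩ | ⟨rfl, rfl⟩ | ⟨rfl, rfl⟩ | ⟨rfl, rfl⟩ <;> simp [krSquare]

theorem IsKRPair.ne (hab : a < b) (hbc : b < c) (h : IsKRPair v t a b c x y) : x ≠ y := by
  rcases h with ⟨rfl, rfl⟩ | ⟨rfl, rfl⟩ | ⟨rfl, rfl⟩ | ⟨rfl, rfl⟩ <;>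
    simp [hab.ne, hab.ne', hbc.ne, hbc.ne', (hab.trans hbc).ne']

theorem length_of_mem_krSquare (h : x ∈ krSquare v t a b c) :
    x.length = v.length + 3 + t.length := by
  rcases h with rfl | rfl | rfl | rfl <;>
    simp only [List.length_append, List.length_cons, List.length_nil, zero_add, Nat.reduceAdd]

theorem eq_of_mem_krSquare {v' t' : List (Fin N)} {a' b' c' : Fin N}
    (hab : a < b) (hbc : b < c) (hab' : a' < b') (hbc' : b' < c') (hv : v.length = v'.length)
    (hx : x ∈ krSquare v t a b c) (hx' : x ∈ krSquare v' t' a' b' c') :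
    v = v' ∧ t = t' ∧ a = a' ∧ b = b' ∧ c = c' := by
  have hsplit : ∀ m m' : List (Fin N), m.length = 3 → m'.length = 3 →
      v ++ m ++ t = v' ++ m' ++ t' → v = v' ∧ m = m' ∧ t = t' := fun m m' hm hm' h => by
    obtain ⟨hvm, ht⟩ := List.append_inj h (by simp [hv, hm, hm'])
    exact ⟨(List.append_inj hvm hv).1, (List.append_inj hvm hv).2, ht⟩
  rcases hx with rfl | rfl | rfl | rfl <;> rcases hx' with h | h | h | h <;>
    obtain ⟨rfl, hm, rfl⟩ := hsplit _ _ rfl rfl h <;>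
    simp only [List.cons.injEq, and_true] at hm <;>
    grind

theorem existsUnique_matched {α : Type*} {p q r s : α} (hpq : p ≠ q) (hpr : p ≠ r) (hps : p ≠ s)
    (hqr : q ≠ r) (hqs : q ≠ s) (hrs : r ≠ s) {x : α} (hx : x = p ∨ x = q ∨ x = r ∨ x = s) :
    ∃! y, (x = p ∧ y = q ∨ x = r ∧ y = s) ∨ (y = p ∧ x = q ∨ y = r ∧ x = s) := by
  rcases hx with rfl | rfl | rfl | rfl
  · exact ⟨q, by simp, by grind⟩
  · exact ⟨p, by simp, by grind⟩
  · exact ⟨s, by simp, by grind⟩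
  · exact ⟨r, by simp, by grind⟩

theorem existsUnique_isKnuthPair (hab : a < b) (hbc : b < c) (hx : x ∈ krSquare v t a b c) :
    ∃! y, IsKnuthPair v t a b c x y ∨ IsKnuthPair v t a b c y x := by
  refine existsUnique_matched ?_ ?_ ?_ ?_ ?_ ?_ hx <;>
    simp [hab.ne, hab.ne', hbc.ne, hbc.ne', (hab.trans hbc).ne, (hab.trans hbc).ne']

theorem existsUnique_isRotationPair (hab : a < b) (hbc : b < c) (hx : x ∈ krSquare v t a b c) :
    ∃! y, IsRotationPair v t a b c x y ∨ IsRotationPair v t a b c y x := by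
  refine existsUnique_matched ?_ ?_ ?_ ?_ ?_ ?_ (hx.imp_right or_left_comm.1) <;>
    simp [hab.ne, hab.ne', hbc.ne, hbc.ne', (hab.trans hbc).ne, (hab.trans hbc).ne']

/-- The pairs of a square that become edges of `squareGraph W`: the Knuth pairs if `W` is a union
of these within the square, and the rotation pairs otherwise. -/
def IsEdgePair (W : Set (List (Fin N))) (v t : List (Fin N)) (a b c : Fin N)
    (x y : List (Fin N)) : Prop :=
  KnuthClosed W v t a b c ∧ IsKnuthPair v t a b c x y ∨
    ¬ KnuthClosed W v t a b c ∧ IsRotationPair v t a b c x y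

theorem IsEdgePair.isKRPair (h : IsEdgePair W v t a b c x y) : IsKRPair v t a b c x y :=
  isKRPair_iff.2 (h.imp And.right And.right)

theorem IsEdgePair.mem_iff (hW : Balanced W) (hab : a < b) (hbc : b < c)
    (h : IsEdgePair W v t a b c x y) : x ∈ W ↔ y ∈ W := by
  rcases h with ⟨hK, h⟩ | ⟨hK, h⟩
  · exact hK x y h
  · exact ((balanced_iff_knuthClosed_or_rotationClosed.1 hW v t a b c hab hbc).resolve_left hK)
      x y h

theorem existsUnique_isEdgePair (hab : a < b) (hbc : b < c) (hx : x ∈ krSquare v t a b c) :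
    ∃! y, IsEdgePair W v t a b c x y ∨ IsEdgePair W v t a b c y x := by
  by_cases hK : KnuthClosed W v t a b c
  · simpa [IsEdgePair, hK] using existsUnique_isKnuthPair hab hbc hx
  · simpa [IsEdgePair, hK] using existsUnique_isRotationPair hab hbc hx

/-- The graph of the `i`-edges of the D₀ graph constructed on a balanced set `W`. -/
def squareGraph (W : Set (List (Fin N))) (i : ℕ) : SimpleGraph (List (Fin N)) where
  Adj x y := x ∈ W ∧ y ∈ W ∧ ∃ (v t : List (Fin N)) (a b c : Fin N), v.length + 2 = i ∧
    a < b ∧ b < c ∧ (IsEdgePair W v t a b c x y ∨ IsEdgePair W v t a b c y x)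
  symm := ⟨fun _ _ ⟨hx, hy, v, t, a, b, c, hv, hab, hbc, h⟩ =>
    ⟨hy, hx, v, t, a, b, c, hv, hab, hbc, h.symm⟩⟩
  loopless := ⟨fun _ ⟨_, _, _, _, _, _, _, _, hab, hbc, h⟩ =>
    h.elim (fun h => h.isKRPair.ne hab hbc rfl) fun h => h.isKRPair.ne hab hbc rfl⟩

theorem squareGraph_adj_iff (hW : Balanced W) (hab : a < b) (hbc : b < c) (hx : x ∈ W)
    (hxs : x ∈ krSquare v t a b c) :
    (squareGraph W (v.length + 2)).Adj x y ↔
      IsEdgePair W v t a b c x y ∨ IsEdgePair W v t a b c y x := by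
  constructor
  · rintro ⟨-, -, v', t', a', b', c', hv, hab', hbc', h⟩
    have hxs' : x ∈ krSquare v' t' a' b' c' :=
      h.elim (fun h => h.isKRPair.mem_krSquare.1) fun h => h.isKRPair.mem_krSquare.2
    obtain ⟨rfl, rfl, rfl, rfl, rfl⟩ := eq_of_mem_krSquare hab hbc hab' hbc' (by omega) hxs hxs'
    exact h
  · intro h
    have hy : y ∈ W :=
      h.elim (fun h => (h.mem_iff hW hab hbc).1 hx) fun h => (h.mem_iff hW hab hbc).2 hx
    exact ⟨hx, hy, v, t, a, b, c, rfl, hab, hbc, h⟩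

theorem exists_d0Graph {n : ℕ} {W : Finset (List (Fin N))} (hstd : ∀ w ∈ W, IsStdWord n w)
    (hW : Balanced (W : Set (List (Fin N)))) : ∃ G : D0Graph N n, G.verts = W :=
  ⟨{ verts := W
     verts_std := hstd
     edge := squareGraph W
     edge_mem := fun _ _ _ h => ⟨h.1, h.2.1⟩
     edge_color := fun i x y ⟨hx, _, v, t, a, b, c, hv, _, _, h⟩ => by
       have hlen := length_of_mem_krSquare
         (h.elim (fun h => h.isKRPair.mem_krSquare.1) fun h => h.isKRPair.mem_krSquare.2)
       have hn := (hstd x hx).1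
       omega
     edge_type := fun _ _ _ ⟨_, _, v, t, a, b, c, hv, hab, hbc, h⟩ =>
       ⟨v, t, a, b, c, hv, hab, hbc, h.imp IsEdgePair.isKRPair IsEdgePair.isKRPair⟩
     edge_unique := fun v t a b c hab hbc x hx hxs => by
       simp only [squareGraph_adj_iff hW hab hbc hx hxs]
       exact existsUnique_isEdgePair hab hbc hxs }, rfl⟩

end D0Graph

/-! ### The bilinear form -/

/-- The pairing with a fixed element, as an additive map. -/
def pairingHom (g : U N) : U N →+ ℤ where
  toFun f := pairing f g
  map_zero' := Finsupp.sum_zero_index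
  map_add' _ _ := Finsupp.sum_add_index' (by simp) (by simp [add_mul])

theorem pairingHom_mono (w : List (Fin N)) (g : U N) :
    pairingHom g (mono w) = g.coeff (FreeMonoid.ofList w) := by
  change pairing _ _ = _
  rw [pairing, mono, MonoidAlgebra.coeff_single, Finsupp.sum_single_index (by simp), one_mul]

theorem mono_mul_mono (v w : List (Fin N)) : mono v * mono w = mono (v ++ w) := by
  rw [mono, mono, MonoidAlgebra.single_mul_single, mul_one]
  rfl

theorem pairingHom_wordSum_mono (W : Finset (List (Fin N))) (w : List (Fin N)) :
    pairingHom (wordSum W) (mono w) = (W : Set (List (Fin N))).indicator 1 w := by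
  classical
  rw [pairingHom_mono, wordSum, MonoidAlgebra.coeff_sum, Finsupp.finsetSum_apply]
  simp [mono, Finsupp.single_apply, Set.indicator_apply]

theorem mem_perp_span {S : Set (U N)} {g : U N}
    (h : ∀ s ∈ S, ∀ v t : List (Fin N), pairingHom g (mono v * s * mono t) = 0) :
    g ∈ perp (TwoSidedIdeal.span S) := by
  have hS : ∀ s ∈ S, ∀ f f' : U N, pairingHom g (f * s * f') = 0 := fun s hs f f' => by
    have hsingle : ∀ (w : FreeMonoid (Fin N)) (r : ℤ),
        MonoidAlgebra.single w r = r • mono w.toList := fun w r => by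
      rw [mono, MonoidAlgebra.smul_single, smul_eq_mul, mul_one]
      rfl
    induction f using MonoidAlgebra.induction_linear with
    | zero => simp
    | add f₁ f₂ h₁ h₂ => rw [add_mul, add_mul, map_add, h₁, h₂, add_zero]
    | single v r =>
      induction f' using MonoidAlgebra.induction_linear with
      | zero => simp
      | add f₁ f₂ h₁ h₂ => rw [mul_add, map_add, h₁, h₂, add_zero]
      | single t r' =>
        rw [hsingle, hsingle, smul_mul_assoc, smul_mul_assoc, mul_smul_comm, map_zsmul, map_zsmul,
          h s hs, smul_zero, smul_zero]
  intro z hz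
  rw [TwoSidedIdeal.mem_span_iff_mem_addSubgroup_closure] at hz
  refine (AddSubgroup.closure_le (pairingHom g).ker).2 ?_ hz
  rintro _ ⟨_, ⟨f, -, s, hs, rfl⟩, f', -, rfl⟩
  exact hS s hs f f'

theorem wordSum_mem_perp {W : Finset (List (Fin N))} (hW : ∀ w ∈ W, w.Nodup)
    (hb : Balanced (W : Set (List (Fin N)))) : wordSum W ∈ perp (idealKR N) := by
  refine mem_perp_span fun s hs v t => ?_
  rcases hs with ⟨a, b, c, hab, hbc, rfl⟩ | ⟨w, hw, rfl⟩
  · have hexpand : mono v * (var b * (var a * var c - var c * var a) -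
        (var a * var c - var c * var a) * var b) * mono t =
        mono (v ++ [b, a, c] ++ t) - mono (v ++ [b, c, a] ++ t) -
          (mono (v ++ [a, c, b] ++ t) - mono (v ++ [c, a, b] ++ t)) := by
      simp only [var, mul_sub, sub_mul, mono_mul_mono]
      rfl
    rw [hexpand]
    simp only [map_sub, pairingHom_wordSum_mono]
    linear_combination hb v t a b c hab hbc
  · rw [mono_mul_mono, mono_mul_mono, pairingHom_wordSum_mono]
    refine Set.indicator_of_notMem (fun hmem => hw ?_) _
    exact (hW _ hmem).sublist (List.IsInfix.sublist ⟨v, t, rfl⟩)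

/-! ### Row insertion and Knuth relations -/

section Insertion

variable {a b c x y : Fin N} {r : List (Fin N)} {T : List (List (Fin N))}

theorem rowInsert_cons_of_lt (h : x < y) : rowInsert x (y :: r) = (x :: r, some y) :=
  if_pos h

theorem rowInsert_cons_of_le (h : y ≤ x) :
    rowInsert x (y :: r) = (y :: (rowInsert x r).1, (rowInsert x r).2) :=
  if_neg h.not_gt

theorem mem_rowInsert_self (x : Fin N) (r : List (Fin N)) : x ∈ (rowInsert x r).1 := by
  induction r with
  | nil => exact List.mem_singleton_self x
  | cons y r ih =>
    rcases lt_or_ge x y with h | h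
    · simp [rowInsert_cons_of_lt h]
    · simp [rowInsert_cons_of_le h, ih]

theorem eq_or_mem_of_mem_rowInsert (h : y ∈ (rowInsert x r).1) : y = x ∨ y ∈ r := by
  induction r with
  | nil => exact .inl (List.mem_singleton.1 h)
  | cons z r ih =>
    rcases lt_or_ge x z with hx | hx
    · rw [rowInsert_cons_of_lt hx] at h
      exact (List.mem_cons.1 h).imp_right (List.mem_cons_of_mem z)
    · rw [rowInsert_cons_of_le hx] at h
      rcases List.mem_cons.1 h with rfl | h
      · exact .inr List.mem_cons_self
      · exact (ih h).imp_right (List.mem_cons_of_mem z)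

theorem lt_and_mem_of_rowInsert_eq_some (h : (rowInsert x r).2 = some y) : x < y ∧ y ∈ r := by
  induction r with
  | nil => cases h
  | cons z r ih =>
    rcases lt_or_ge x z with hx | hx
    · rw [rowInsert_cons_of_lt hx] at h
      cases h
      exact ⟨hx, List.mem_cons_self⟩
    · rw [rowInsert_cons_of_le hx] at h
      exact ⟨(ih h).1, List.mem_cons_of_mem z (ih h).2⟩

theorem exists_rowInsert_eq_some_le (hr : r.Pairwise (· ≤ ·)) (hy : y ∈ r) (hxy : x < y) :
    ∃ z, (rowInsert x r).2 = some z ∧ z ≤ y := by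
  induction r with
  | nil => cases hy
  | cons z r ih =>
    rw [List.pairwise_cons] at hr
    rcases lt_or_ge x z with hx | hx
    · refine ⟨z, by rw [rowInsert_cons_of_lt hx], ?_⟩
      rcases List.mem_cons.1 hy with rfl | hy
      exacts [le_rfl, hr.1 y hy]
    · rw [rowInsert_cons_of_le hx]
      exact ih hr.2 ((List.mem_cons.1 hy).resolve_left (hx.trans_lt hxy).ne')

theorem pairwise_le_rowInsert (hr : r.Pairwise (· ≤ ·)) :
    (rowInsert x r).1.Pairwise (· ≤ ·) := by
  induction r with
  | nil => exact List.pairwise_singleton _ x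
  | cons y r ih =>
    rw [List.pairwise_cons] at hr
    rcases lt_or_ge x y with hx | hx
    · rw [rowInsert_cons_of_lt hx]
      exact List.pairwise_cons.2 ⟨fun z hz => hx.le.trans (hr.1 z hz), hr.2⟩
    · rw [rowInsert_cons_of_le hx]
      refine List.pairwise_cons.2 ⟨fun z hz => ?_, ih hr.2⟩
      rcases eq_or_mem_of_mem_rowInsert hz with rfl | hz
      exacts [hx, hr.1 z hz]

theorem exists_rowInsert_eq_some_le_of_rowInsert_rowInsert (hr : r.Pairwise (· ≤ ·)) (hbc : b ≤ c)
    (h : (rowInsert c (rowInsert b r).1).2 = some x) : ∃ z, (rowInsert b r).2 = some z ∧ z ≤ x := by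
  obtain ⟨hcx, hmem⟩ := lt_and_mem_of_rowInsert_eq_some h
  have hbx := hbc.trans_lt hcx
  exact exists_rowInsert_eq_some_le hr
    ((eq_or_mem_of_mem_rowInsert hmem).resolve_left hbx.ne') hbx

/-- Insertion of a word into a row, letter by letter: the resulting row, and the word of the letters
bumped out. -/
def rowInsertWord : List (Fin N) → List (Fin N) → List (Fin N) × List (Fin N)
  | [], r => (r, [])
  | x :: w, r =>
    ((rowInsertWord w (rowInsert x r).1).1,
      (rowInsert x r).2.toList ++ (rowInsertWord w (rowInsert x r).1).2)

/-- Insertion of a word into a tableau, letter by letter. -/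
def tabInsertWord (w : List (Fin N)) (T : List (List (Fin N))) : List (List (Fin N)) :=
  w.foldl (fun T x => tabInsert x T) T

theorem tabInsert_cons (x : Fin N) (r : List (Fin N)) (T : List (List (Fin N))) :
    tabInsert x (r :: T) = (rowInsert x r).1 :: tabInsertWord (rowInsert x r).2.toList T := by
  rw [tabInsert]
  rcases rowInsert x r with ⟨r', _ | y⟩ <;> rfl

theorem tabInsertWord_append (v w : List (Fin N)) (T : List (List (Fin N))) :
    tabInsertWord (v ++ w) T = tabInsertWord w (tabInsertWord v T) :=
  List.foldl_append

theorem tabInsertWord_cons_row (w r : List (Fin N)) (T : List (List (Fin N))) :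
    tabInsertWord w (r :: T) = (rowInsertWord w r).1 :: tabInsertWord (rowInsertWord w r).2 T := by
  induction w generalizing r T with
  | nil => rfl
  | cons x w ih =>
    rw [rowInsertWord, tabInsertWord_append, ← ih, ← tabInsert_cons]
    rfl

theorem rowInsertWord_cons_of_forall_le {w : List (Fin N)} (h : ∀ x ∈ w, y ≤ x) :
    rowInsertWord w (y :: r) = (y :: (rowInsertWord w r).1, (rowInsertWord w r).2) := by
  induction w generalizing r with
  | nil => rfl
  | cons x w ih =>
    rw [List.forall_mem_cons] at h
    simp only [rowInsertWord, rowInsert_cons_of_le h.1, ih h.2]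

/-- The elementary Knuth relations between three-letter words, including the degenerate cases with
repeated letters. -/
inductive KnuthRel : List (Fin N) → List (Fin N) → Prop
  | refl (w : List (Fin N)) : KnuthRel w w
  | symm {v w : List (Fin N)} : KnuthRel v w → KnuthRel w v
  | knuth₁ {a b c : Fin N} : a < b → b ≤ c → KnuthRel [b, a, c] [b, c, a]
  | knuth₂ {a b c : Fin N} : a ≤ b → b < c → KnuthRel [a, c, b] [c, a, b]

theorem rowInsertWord_knuth₁ (hr : r.Pairwise (· ≤ ·)) (hab : a < b) (hbc : b ≤ c) :
    (rowInsertWord [b, a, c] r).1 = (rowInsertWord [b, c, a] r).1 ∧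
      KnuthRel (rowInsertWord [b, a, c] r).2 (rowInsertWord [b, c, a] r).2 := by
  induction r with
  | nil =>
    simpa [rowInsertWord, rowInsert, hab, hbc.not_gt, (hab.trans_le hbc).not_gt] using .refl _
  | cons y r ih =>
    rw [List.pairwise_cons] at hr
    rcases le_or_gt y a with hya | hay
    · have hby := hya.trans hab.le
      rw [rowInsertWord_cons_of_forall_le (by simp [hya, hby, hby.trans hbc]),
        rowInsertWord_cons_of_forall_le (by simp [hya, hby, hby.trans hbc])]
      exact ⟨congrArg (y :: ·) (ih hr.2).1, (ih hr.2).2⟩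
    have hac := hab.le.trans hbc
    rcases le_or_gt y b with hyb | hby
    · simp only [rowInsertWord, rowInsert_cons_of_le hyb, rowInsert_cons_of_lt hay,
        rowInsert_cons_of_le hac, rowInsert_cons_of_le (hyb.trans hbc), true_and]
      rcases ho' : (rowInsert c (rowInsert b r).1).2 with _ | c'
      · simpa using .refl _
      · obtain ⟨b', ho, hb'⟩ := exists_rowInsert_eq_some_le_of_rowInsert_rowInsert hr.2 hbc ho'
        rw [ho]
        exact .knuth₁ (hyb.trans_lt (lt_and_mem_of_rowInsert_eq_some ho).1) hb'
    · simp only [rowInsertWord, rowInsert_cons_of_lt hby, rowInsert_cons_of_lt hab,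
        rowInsert_cons_of_le hac, rowInsert_cons_of_le hbc, true_and]
      rcases ho : (rowInsert c r).2 with _ | c'
      · simpa using .refl _
      · exact .knuth₁ hby (hr.1 c' (lt_and_mem_of_rowInsert_eq_some ho).2)

theorem rowInsertWord_knuth₂ (hr : r.Pairwise (· ≤ ·)) (hab : a ≤ b) (hbc : b < c) :
    (rowInsertWord [a, c, b] r).1 = (rowInsertWord [c, a, b] r).1 ∧
      KnuthRel (rowInsertWord [a, c, b] r).2 (rowInsertWord [c, a, b] r).2 := by
  have hac := hab.trans_lt hbc
  induction r with
  | nil => simpa [rowInsertWord, rowInsert, hab.not_gt, hbc, hac, hac.not_gt] using .refl _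
  | cons y r ih =>
    rw [List.pairwise_cons] at hr
    rcases le_or_gt y a with hya | hay
    · rw [rowInsertWord_cons_of_forall_le (by simp [hya, hya.trans hab, hya.trans hac.le]),
        rowInsertWord_cons_of_forall_le (by simp [hya, hya.trans hab, hya.trans hac.le])]
      exact ⟨congrArg (y :: ·) (ih hr.2).1, (ih hr.2).2⟩
    rcases le_or_gt y c with hyc | hcy
    · simp only [rowInsertWord, rowInsert_cons_of_lt hay, rowInsert_cons_of_le hac.le,
        rowInsert_cons_of_le hyc, rowInsert_cons_of_le hab, true_and]
      rcases ho : (rowInsert c r).2 with _ | c'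
      · exact .refl _
      · obtain ⟨b', ho', hb'⟩ := exists_rowInsert_eq_some_le (pairwise_le_rowInsert hr.2)
          (mem_rowInsert_self c r) hbc
        have hyb' : y ≤ b' := by
          rcases eq_or_mem_of_mem_rowInsert (lt_and_mem_of_rowInsert_eq_some ho').2 with rfl | h
          exacts [hyc, hr.1 b' h]
        rw [ho']
        exact .knuth₂ hyb' (hb'.trans_lt (lt_and_mem_of_rowInsert_eq_some ho).1)
    · cases r with
      | nil =>
        simpa [rowInsertWord, rowInsert, hay, hcy, hab.not_gt, hbc, hac, hac.not_gt] using .refl _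
      | cons z r =>
        have hyz := hr.1 z List.mem_cons_self
        have hcz := hcy.trans_le hyz
        simp only [rowInsertWord, rowInsert_cons_of_lt hay, rowInsert_cons_of_lt hcy,
          rowInsert_cons_of_le hac.le, rowInsert_cons_of_lt hcz, rowInsert_cons_of_le hab,
          rowInsert_cons_of_lt hbc, rowInsert_cons_of_lt hac, rowInsert_cons_of_lt (hbc.trans hcz),
          true_and]
        exact (KnuthRel.knuth₁ hcy hyz).symm

theorem KnuthRel.rowInsertWord {v w : List (Fin N)} (h : KnuthRel v w)
    (hr : r.Pairwise (· ≤ ·)) : (rowInsertWord v r).1 = (rowInsertWord w r).1 ∧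
      KnuthRel (rowInsertWord v r).2 (rowInsertWord w r).2 := by
  induction h with
  | refl => exact ⟨rfl, .refl _⟩
  | symm _ ih => exact ⟨ih.1.symm, ih.2.symm⟩
  | knuth₁ hab hbc => exact rowInsertWord_knuth₁ hr hab hbc
  | knuth₂ hab hbc => exact rowInsertWord_knuth₂ hr hab hbc

theorem KnuthRel.tabInsertWord_eq {v w : List (Fin N)} (h : KnuthRel v w)
    (hT : ∀ r ∈ T, r.Pairwise (· ≤ ·)) : tabInsertWord v T = tabInsertWord w T := by
  induction T generalizing v w with
  | nil =>
    induction h with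
    | refl => rfl
    | symm _ ih => exact ih.symm
    | knuth₁ hab hbc =>
      simp [tabInsertWord, tabInsert, rowInsert, hab, hbc.not_gt, (hab.trans_le hbc).not_gt]
    | knuth₂ hab hbc =>
      simp [tabInsertWord, tabInsert, rowInsert, hab.not_gt, hbc, hab.trans_lt hbc,
        (hab.trans_lt hbc).not_gt]
  | cons r T ih =>
    rw [List.forall_mem_cons] at hT
    obtain ⟨hrow, hbump⟩ := h.rowInsertWord hT.1
    rw [tabInsertWord_cons_row, tabInsertWord_cons_row, hrow, ih hbump hT.2]

theorem forall_pairwise_le_tabInsert (hT : ∀ r ∈ T, r.Pairwise (· ≤ ·)) :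
    ∀ r ∈ tabInsert x T, r.Pairwise (· ≤ ·) := by
  induction T generalizing x with
  | nil => simp [tabInsert]
  | cons r T ih =>
    rw [List.forall_mem_cons] at hT
    rw [tabInsert_cons, List.forall_mem_cons]
    refine ⟨pairwise_le_rowInsert hT.1, ?_⟩
    cases (rowInsert x r).2 with
    | none => exact hT.2
    | some y => exact ih hT.2

theorem forall_pairwise_le_insTab (w : List (Fin N)) : ∀ r ∈ insTab w, r.Pairwise (· ≤ ·) := by
  induction w using List.reverseRecOn with
  | nil => simp [insTab]
  | append_singleton w x ih =>
    rw [insTab, List.foldl_append]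
    exact forall_pairwise_le_tabInsert ih

theorem insTab_eq_of_knuthRel {m m' : List (Fin N)} (h : KnuthRel m m') (v t : List (Fin N)) :
    insTab (v ++ m ++ t) = insTab (v ++ m' ++ t) := by
  change tabInsertWord _ [] = tabInsertWord _ []
  simp only [tabInsertWord_append]
  exact congrArg _ (h.tabInsertWord_eq (forall_pairwise_le_insTab v))

theorem insTab_eq_of_isKnuthPair {v t x y : List (Fin N)} (hab : a < b) (hbc : b < c)
    (h : IsKnuthPair v t a b c x y) : insTab x = insTab y := by
  rcases h with ⟨rfl, rfl⟩ | ⟨rfl, rfl⟩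
  · exact insTab_eq_of_knuthRel (.knuth₁ hab hbc.le) v t
  · exact insTab_eq_of_knuthRel (.knuth₂ hab.le hbc) v t

theorem balanced_insTab (S : Set (List (List (Fin N)))) : Balanced {w | insTab w ∈ S} :=
  balanced_iff_knuthClosed_or_rotationClosed.2 fun _ _ _ _ _ hab hbc => .inl fun x y h => by
    rw [Set.mem_ofPred_eq, Set.mem_ofPred_eq, insTab_eq_of_isKnuthPair hab hbc h]

end Insertion

/-! ### LLT equivalence classes -/

section LLT

theorem pair_sublist_append {α : Type*} {x y : α} {l₁ l₂ : List α} :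
    [x, y].Sublist (l₁ ++ l₂) ↔
      [x, y].Sublist l₁ ∨ x ∈ l₁ ∧ y ∈ l₂ ∨ [x, y].Sublist l₂ := by
  induction l₁ with
  | nil => simp
  | cons z l ih =>
    simp only [List.cons_append, List.cons_sublist_cons', ih, List.singleton_sublist,
      List.mem_append, List.mem_cons]
    tauto

theorem occursBefore_iff {w : List (Fin N)} {p q : ℤ} :
    OccursBefore w p q ↔ ∃ x y : Fin N, letterVal x = p ∧ letterVal y = q ∧ [x, y].Sublist w := by
  constructor
  · rintro ⟨i, j, hij, rfl, rfl⟩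
    refine ⟨_, _, rfl, rfl, ?_⟩
    have hi : w[i] ∈ w.take j := List.mem_take_iff_getElem.2 ⟨i, by simp [hij], rfl⟩
    have hj : w[j] ∈ w.drop j := List.mem_drop_iff_getElem.2 ⟨0, by simp, by simp⟩
    simpa only [List.take_append_drop] using pair_sublist_append.2 (.inr (.inl ⟨hi, hj⟩))
  · rintro ⟨x, y, rfl, rfl, h⟩
    obtain ⟨l₁, l₂, rfl, hx, hy⟩ := List.cons_sublist_iff.1 h
    obtain ⟨i, hi, rfl⟩ := List.getElem_of_mem hx
    obtain ⟨j, hj, rfl⟩ := List.getElem_of_mem (List.singleton_sublist.1 hy)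
    refine ⟨⟨i, by simp; omega⟩, ⟨l₁.length + j, by simp [hj]⟩, Fin.mk_lt_mk.2 (by omega), ?_, ?_⟩
    · simp [List.getElem_append_left hi]
    · simp [List.getElem_append_right]

theorem occursBefore_letterVal {w : List (Fin N)} {x y : Fin N} :
    OccursBefore w (letterVal x) (letterVal y) ↔ [x, y].Sublist w := by
  simp [occursBefore_iff, letterVal, Fin.val_inj]

theorem sum_ite_getElem {α : Type*} (p : α → Prop) [DecidablePred p] (w : List α) :
    (∑ i : Fin w.length, if p w[i] then 1 else 0) = w.countP p := by
  induction w with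
  | nil => rfl
  | cons x w ih =>
    refine (Fin.sum_univ_succ _).trans ?_
    rw [List.countP_cons, ← ih, add_comm]
    simp only [decide_eq_true_eq]
    rfl

theorem kInv_cons (k : ℕ) (x : Fin N) (w : List (Fin N)) :
    kInv k (x :: w) = w.countP (fun y => y < x ∧ x.val < y.val + k) + kInv k w := by
  simp only [kInv, Finset.card_filter, ← Finset.univ_product_univ, Finset.sum_product]
  refine (Fin.sum_univ_succ _).trans (congrArg₂ (· + ·) ?_ ?_)
  · rw [← sum_ite_getElem]
    refine (Fin.sum_univ_succ _).trans ?_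
    simp only [lt_irrefl, false_and, if_false, zero_add, Fin.succ_pos, true_and]
    refine Finset.sum_congr rfl fun i _ => if_congr ?_ rfl rfl
    simp only [letterVal, Fin.getElem_fin, Fin.val_zero, List.getElem_cons_zero, Fin.val_succ,
      List.getElem_cons_succ, Fin.lt_def]
    omega
  · refine Finset.sum_congr rfl fun i _ => (Fin.sum_univ_succ _).trans ?_
    simp [Fin.succ_lt_succ_iff]

theorem kInv_append (k : ℕ) (v w : List (Fin N)) : kInv k (v ++ w) =
    kInv k v + (v.map fun x => w.countP fun y => y < x ∧ x.val < y.val + k).sum + kInv k w := by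
  induction v with
  | nil => simp [kInv]
  | cons x v ih =>
    rw [List.cons_append, kInv_cons, kInv_cons, ih, List.countP_append, List.map_cons,
      List.sum_cons]
    ring

variable {k : ℕ} {v t m m' : List (Fin N)}

theorem kInv_congr (h : m.Perm m') (hk : kInv k m = kInv k m') (v t : List (Fin N)) :
    kInv k (v ++ m ++ t) = kInv k (v ++ m' ++ t) := by
  simp only [kInv_append, hk, List.map_append, List.sum_append, h.countP_eq, (h.map _).sum_eq]

theorem pair_sublist_congr {x y : Fin N} (h : m.Perm m')
    (hs : [x, y].Sublist m ↔ [x, y].Sublist m') (v t : List (Fin N)) :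
    [x, y].Sublist (v ++ m ++ t) ↔ [x, y].Sublist (v ++ m' ++ t) := by
  simp only [pair_sublist_append, List.mem_append, hs, h.mem_iff]

theorem mem_lltWords_congr {β : Fin k → SkewShape} {w w' : List (Fin N)} (h : w.Perm w')
    (hs : ∀ x y : Fin N, y.val = x.val + k ∨ x.val = y.val + k →
      ([x, y].Sublist w ↔ [x, y].Sublist w')) :
    w ∈ lltWords N β ↔ w' ∈ lltWords N β := by
  refine and_congr h.nodup_iff (and_congr (by rw [Multiset.coe_eq_coe.2 h]) ?_)
  refine forall₅_congr fun i z _ z' _ => forall_congr' fun hz => ?_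
  simp only [occursBefore_iff]
  refine exists₂_congr fun x y => and_congr_right fun hx => and_congr_right fun hy => hs x y ?_
  rcases hz with rfl | rfl <;> simp only [letterVal, shiftedContent] at hx hy <;> push_cast at hy
  · left
    zify
    linear_combination hy - hx
  · right
    zify
    linear_combination hx - hy

theorem mem_lltWords_and_kInv_congr {β : Fin k → SkewShape} {n : ℕ} (h : m.Perm m')
    (hs : ∀ x y : Fin N, y.val = x.val + k ∨ x.val = y.val + k →
      ([x, y].Sublist m ↔ [x, y].Sublist m')) (hk : kInv k m = kInv k m') :
    v ++ m ++ t ∈ {w | w ∈ lltWords N β ∧ kInv k w = n} ↔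
      v ++ m' ++ t ∈ {w | w ∈ lltWords N β ∧ kInv k w = n} :=
  and_congr (mem_lltWords_congr ((h.append_left v).append_right t)
    fun x y hxy => pair_sublist_congr h (hs x y hxy) v t) (by rw [kInv_congr h hk])

theorem balanced_lltWords_kInv (β : Fin k → SkewShape) (n : ℕ) :
    Balanced {w | w ∈ lltWords N β ∧ kInv k w = n} := by
  refine balanced_iff_knuthClosed_or_rotationClosed.2 fun v t a b c hab hbc => ?_
  rw [Fin.lt_def] at hab hbc
  rcases lt_or_ge (a.val + k) c.val with hac | hac
  · left
    rintro _ _ (⟨rfl, rfl⟩ | ⟨rfl, rfl⟩) <;>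
      [refine mem_lltWords_and_kInv_congr ((List.Perm.swap c a []).cons b) (fun x y hxy => ?_) ?_;
      refine mem_lltWords_and_kInv_congr (List.Perm.swap c a [b]) (fun x y hxy => ?_) ?_] <;>
    simp only [List.cons_sublist_cons', List.singleton_sublist, Fin.ext_iff, kInv_cons,
      List.countP_cons, List.countP_nil, Fin.lt_def, decide_eq_true_eq] <;>
    grind
  · right
    rintro _ _ (⟨rfl, rfl⟩ | ⟨rfl, rfl⟩) <;>
    refine mem_lltWords_and_kInv_congr (List.perm_append_comm (l₁ := [b]))
      (fun x y hxy => ?_) ?_ <;>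
    simp only [List.cons_sublist_cons', List.singleton_sublist, Fin.ext_iff, kInv_cons,
      List.countP_cons, List.countP_nil, Fin.lt_def, decide_eq_true_eq] <;>
    grind

end LLT

/-! ### The three parts of `W*` -/

section Parts

theorem coe_eq_univ_val {w : List (Fin N)} (hw : w ∈ permWords N) :
    (w : Multiset (Fin N)) = Finset.univ.val :=
  (Multiset.Nodup.ext (Multiset.coe_nodup.2 (mem_permWords.1 hw).2) Finset.univ.nodup).2 fun a =>
    iff_of_true (mem_of_mem_permWords hw a) (Finset.mem_univ a)

theorem mem_lltWords_iff {k : ℕ} {β : Fin k → SkewShape}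
    (hβ : (Finset.univ : Finset (Fin N)).val.map letterVal =
      ∑ i : Fin k, (β i).cells.val.map (shiftedContent k i))
    {w : List (Fin N)} (hw : w ∈ permWords N) :
    w ∈ lltWords N β ↔ ∀ (i : Fin k), ∀ z ∈ (β i).cells, ∀ z' ∈ (β i).cells,
      (z' = (z.1, z.2 + 1) ∨ z' = (z.1 + 1, z.2)) →
        OccursBefore w (shiftedContent k i z) (shiftedContent k i z') :=
  ⟨fun h => h.2.2, fun h => ⟨(mem_permWords.1 hw).2, by rw [coe_eq_univ_val hw, hβ], h⟩⟩

theorem cells_beta3 : (beta3 0).cells = {(0, 2), (1, 2)} ∧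
    (beta3 1).cells = {(0, 2), (1, 2), (2, 2)} ∧ (beta3 2).cells = {(0, 2), (1, 2), (2, 2)} := by
  decide

theorem cells_beta7 : (beta7 0).cells = {(0, 1)} ∧ (beta7 1).cells = {(0, 0), (0, 1)} ∧
    (beta7 2).cells = {(0, 0)} ∧ (beta7 3).cells = {(0, 0)} ∧ (beta7 4).cells = {(0, 0)} ∧
    (beta7 5).cells = {(0, 0)} ∧ (beta7 6).cells = {(0, 0)} := by
  decide

theorem mem_lltWords_beta3 {w : List (Fin 8)} (hw : w ∈ permWords 8) :
    w ∈ lltWords 8 beta3 ↔ ∀ x : Fin 5, [x.addNat 3, x.castAdd 3].Sublist w := by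
  obtain ⟨c0, c1, c2⟩ := cells_beta3
  have occurs : (∀ x : Fin 5, [x.addNat 3, x.castAdd 3].Sublist w) ↔
      OccursBefore w 4 1 ∧ OccursBefore w 5 2 ∧ OccursBefore w 6 3 ∧ OccursBefore w 7 4 ∧
        OccursBefore w 8 5 := by
    simp only [Fin.forall_fin_succ, Fin.forall_fin_zero, and_true, ← occursBefore_letterVal]
    rfl
  have cells_order : w ∈ lltWords 8 beta3 ↔ OccursBefore w 6 3 ∧
      (OccursBefore w 7 4 ∧ OccursBefore w 4 1) ∧ OccursBefore w 8 5 ∧ OccursBefore w 5 2 := by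
    rw [mem_lltWords_iff (β := beta3) (by decide) hw, Fin.forall_fin_succ, Fin.forall_fin_two]
    norm_num [c0, c1, c2, shiftedContent]
  rw [occurs, cells_order]
  exact ⟨fun ⟨h₂, ⟨h₃, h₀⟩, h₄, h₁⟩ => ⟨h₀, h₁, h₂, h₃, h₄⟩,
    fun ⟨h₀, h₁, h₂, h₃, h₄⟩ => ⟨h₂, ⟨h₃, h₀⟩, h₄, h₁⟩⟩

theorem mem_lltWords_beta7 {w : List (Fin 8)} (hw : w ∈ permWords 8) :
    w ∈ lltWords 8 beta7 ↔ [0, 7].Sublist w := by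
  obtain ⟨c0, c1, c2, c3, c4, c5, c6⟩ := cells_beta7
  have occurs : OccursBefore w 1 8 ↔ [0, 7].Sublist w := by
    rw [← occursBefore_letterVal]
    rfl
  rw [← occurs, mem_lltWords_iff (β := beta7) (by decide) hw]
  constructor
  · intro h
    simpa [shiftedContent] using h 1 (0, 0) (by simp [c1]) (0, 1) (by simp [c1]) (by simp)
  · intro h i
    fin_cases i <;> simp [c0, c1, c2, c3, c4, c5, c6, shiftedContent, h]

theorem mem_knuthPart {w : List (Fin 8)} : w ∈ knuthPart ↔ w ∈ permWords 8 ∧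
    (insTab w).map List.length = [2, 2, 2, 2] ∧ insTab w ≠ [[0, 1], [2, 3], [4, 5], [6, 7]] := by
  simp only [knuthPart, Finset.mem_filter]

open Classical in
theorem mem_lltPart3 {w : List (Fin 8)} : w ∈ lltPart3 ↔
    w ∈ permWords 8 ∧ (∀ x : Fin 5, [x.addNat 3, x.castAdd 3].Sublist w) ∧ kInv 3 w = 9 :=
  Finset.mem_filter.trans <| and_congr_right fun hw => by rw [mem_lltWords_beta3 hw]

open Classical in
theorem mem_lltPart7 {w : List (Fin 8)} :
    w ∈ lltPart7 ↔ w ∈ permWords 8 ∧ [0, 7].Sublist w ∧ kInv 7 w = 18 :=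
  Finset.mem_filter.trans <| and_congr_right fun hw => by rw [mem_lltWords_beta7 hw]

theorem balanced_filter_permWords {p : List (Fin N) → Prop} [DecidablePred p]
    (hp : Balanced {w | p w}) : Balanced ((permWords N).filter p : Set (List (Fin N))) := by
  rw [Finset.coe_filter]
  exact hp.permWords_inter

theorem balanced_knuthPart : Balanced (knuthPart : Set (List (Fin 8))) :=
  balanced_filter_permWords <| balanced_insTab
    {T | T.map List.length = [2, 2, 2, 2] ∧ T ≠ [[0, 1], [2, 3], [4, 5], [6, 7]]}

open Classical in
theorem balanced_lltPart3 : Balanced (lltPart3 : Set (List (Fin 8))) :=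
  balanced_filter_permWords (balanced_lltWords_kInv beta3 9)

open Classical in
theorem balanced_lltPart7 : Balanced (lltPart7 : Set (List (Fin 8))) :=
  balanced_filter_permWords (balanced_lltWords_kInv beta7 18)

end Parts

/-! ### Increasing subsequences and the first row -/

section FirstRow

theorem countP_le_countP_rowInsert {x y : Fin N} (r : List (Fin N)) :
    r.countP (· ≤ y) ≤ (rowInsert x r).1.countP (· ≤ y) := by
  induction r with
  | nil => exact Nat.zero_le _
  | cons z r ih =>
    rcases lt_or_ge x z with hxz | hxz
    · rw [rowInsert_cons_of_lt hxz, List.countP_cons, List.countP_cons]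
      have (h : z ≤ y) : x ≤ y := hxz.le.trans h
      grind
    · rw [rowInsert_cons_of_le hxz, List.countP_cons, List.countP_cons]
      omega

theorem countP_lt_countP_rowInsert {x y : Fin N} (hxy : x ≤ y) (r : List (Fin N)) :
    r.countP (· ≤ x) < (rowInsert x r).1.countP (· ≤ y) := by
  induction r with
  | nil => simp [rowInsert, hxy]
  | cons z r ih =>
    rcases lt_or_ge x z with hxz | hxz
    · rw [rowInsert_cons_of_lt hxz, List.countP_cons, List.countP_cons]
      have := List.countP_mono_left (l := r) (p := (· ≤ x)) (q := (· ≤ y)) (by simp; grind)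
      grind
    · rw [rowInsert_cons_of_le hxz, List.countP_cons, List.countP_cons]
      grind

theorem insTab_append_singleton (w : List (Fin N)) (x : Fin N) :
    insTab (w ++ [x]) = tabInsert x (insTab w) := by
  simp [insTab]

theorem headD_tabInsert (x : Fin N) (T : List (List (Fin N))) :
    (tabInsert x T).headD [] = (rowInsert x (T.headD [])).1 := by
  cases T with
  | nil => rfl
  | cons r T => rw [tabInsert_cons, List.headD_cons, List.headD_cons]

theorem length_le_countP_insTab {s w : List (Fin N)} {y : Fin N} (hsw : s.Sublist w)
    (hs : s.Pairwise (· ≤ ·)) (hy : ∀ a ∈ s, a ≤ y) :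
    s.length ≤ ((insTab w).headD []).countP (· ≤ y) := by
  induction w using List.reverseRecOn generalizing s y with
  | nil => simp [List.sublist_nil.1 hsw]
  | append_singleton w x ih =>
    rw [insTab_append_singleton, headD_tabInsert]
    obtain ⟨s, s', rfl, hs_w, hs'⟩ := List.sublist_append_iff.1 hsw
    rcases List.sublist_singleton.1 hs' with rfl | rfl
    · rw [List.append_nil] at hs hy ⊢
      exact (ih hs_w hs hy).trans (countP_le_countP_rowInsert _)
    · rw [List.pairwise_append] at hs
      have hx := ih hs_w hs.1 fun a ha => hs.2.2 a ha x (List.mem_singleton_self x)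
      rw [List.length_append, List.length_singleton]
      exact hx.trans_lt (countP_lt_countP_rowInsert (hy x (by simp)) _)

theorem length_le_length_insTab {s w : List (Fin N)} (hsw : s.Sublist w)
    (hs : s.Pairwise (· ≤ ·)) : s.length ≤ ((insTab w).headD []).length := by
  rcases N with - | N
  · cases s with
    | nil => exact Nat.zero_le _
    | cons a => exact a.elim0
  · exact (length_le_countP_insTab hsw hs fun a _ => Fin.le_last a).trans List.countP_le_length

end FirstRow

/-! ### Pairs of decreasing words -/

section DecrPair

/-- `w` is the concatenation of two strictly decreasing words, of which the first has length `d`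
(for `d ≤ w.length`). -/
def IsDecrPair (d : ℕ) (w : List (Fin N)) : Prop :=
  (w.take d).SortedGT ∧ (w.drop d).SortedGT

theorem exists_isDecrPair_of_length_insTab_le_two {w : List (Fin N)} {x y : Fin N}
    (hw : ((insTab w).headD []).length ≤ 2) (hxy : [x, y].Sublist w) (hx : ∀ a ∈ w, x ≤ a)
    (hy : ∀ a ∈ w, a ≤ y) : ∃ d ≤ w.length, IsDecrPair d w := by
  have not_sublist {a b c : Fin N} (hab : a ≤ b) (hbc : b ≤ c) : ¬ [a, b, c].Sublist w := fun h =>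
    absurd ((length_le_length_insTab h (by simp [hab, hbc, hab.trans hbc])).trans hw) (by simp)
  obtain ⟨u, t, rfl, hxu, hyt⟩ := List.cons_sublist_iff.1 hxy
  obtain ⟨t₁, t₂, rfl⟩ := List.append_of_mem (List.singleton_sublist.1 hyt)
  rw [← List.append_assoc] at not_sublist hx hy ⊢
  have hxu : [x].Sublist (u ++ t₁) := by simp [hxu]
  refine ⟨(u ++ t₁).length, by simp, ?_, ?_⟩
  · rw [List.take_left]
    refine (List.pairwise_iff_forall_sublist.2 fun {a b} hab => ?_).sortedGT
    refine lt_of_not_ge fun h => not_sublist h (hy b ?_) (hab.append (List.singleton_sublist.2 ?_))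
    · exact List.mem_append_left _ (hab.subset (by simp))
    · exact List.mem_cons_self
  · rw [List.drop_left]
    refine (List.pairwise_iff_forall_sublist.2 fun {a b} hab => ?_).sortedGT
    refine lt_of_not_ge fun h => not_sublist (hx a ?_) h (hxu.append hab)
    exact List.mem_append_right _ (hab.subset (by simp))

/-- All the letters, in decreasing order. -/
def lettersDesc (N : ℕ) : List (Fin N) := (List.finRange N).reverse

theorem eq_filter_lettersDesc {u : List (Fin N)} (hu : u.SortedGT) :
    u = (lettersDesc N).filter (· ∈ u) :=
  hu.eq_of_mem_iff ((List.sortedLT_finRange N).reverse.pairwise.filter _).sortedGT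
    fun a => by simp [lettersDesc]

/-- The rearrangements of all the letters that satisfy `IsDecrPair d`: such a word is determined by
its first `d` letters. -/
def decrPairs (N d : ℕ) : List (List (Fin N)) :=
  ((lettersDesc N).sublistsLen d).map fun u => u ++ (lettersDesc N).filter (· ∉ u)

theorem mem_decrPairs {d : ℕ} {w : List (Fin N)} (hd : d ≤ N) :
    w ∈ decrPairs N d ↔ w ∈ permWords N ∧ IsDecrPair d w := by
  constructor
  · intro hw
    obtain ⟨u, hu, rfl⟩ := List.mem_map.1 hw
    obtain ⟨hsub, rfl⟩ := List.mem_sublistsLen.1 hu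
    have hsort : (lettersDesc N).SortedGT := (List.sortedLT_finRange N).reverse
    have hu_sort : u.SortedGT := (hsort.pairwise.sublist hsub).sortedGT
    have ht_sort := (hsort.pairwise.filter fun a => decide (a ∉ u)).sortedGT
    refine ⟨mem_permWords.2 ?_, by rwa [List.take_left], by rwa [List.drop_left]⟩
    have hn : (u ++ (lettersDesc N).filter (· ∉ u)).Nodup :=
      hu_sort.nodup.append ht_sort.nodup fun a h h' => by simp_all
    refine ⟨?_, hn⟩
    have huniv : (u ++ (lettersDesc N).filter (· ∉ u)).toFinset = Finset.univ := by
      ext a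
      simp [lettersDesc, em]
    rw [← List.toFinset_card_of_nodup hn, huniv, Finset.card_univ, Fintype.card_fin]
  · rintro ⟨hw, hdw⟩
    have hn : (w.take d ++ w.drop d).Nodup := by
      simpa only [List.take_append_drop] using (mem_permWords.1 hw).2
    have hmem (a : Fin N) : a ∈ w.drop d ↔ a ∉ w.take d := by
      have ha : a ∈ w.take d ∨ a ∈ w.drop d := by
        simpa only [← List.mem_append, List.take_append_drop] using mem_of_mem_permWords hw a
      exact ⟨fun h h' => List.disjoint_of_nodup_append hn h' h, ha.resolve_left⟩
    refine List.mem_map.2 ⟨w.take d, List.mem_sublistsLen.2 ⟨?_, ?_⟩, ?_⟩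
    · rw [eq_filter_lettersDesc hdw.1]
      exact List.filter_sublist
    · rw [List.length_take_of_le (by rwa [(mem_permWords.1 hw).1])]
    · simp only [← hmem]
      rw [← eq_filter_lettersDesc hdw.2, List.take_append_drop]

end DecrPair

/-! ### Disjointness of the three parts of `W*` -/

section Disjointness

/-- The words of length `n` in which each letter `a`, preceded by the word `u`, satisfies
`p u a`. -/
def stepwiseWords (p : List (Fin N) → Fin N → Bool) : ℕ → List (List (Fin N))
  | 0 => [[]]
  | n + 1 => (stepwiseWords p n).flatMap fun u =>
      ((List.finRange N).filter (p u)).map fun a => u ++ [a]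

theorem mem_stepwiseWords {p : List (Fin N) → Fin N → Bool} {w : List (Fin N)} {n : ℕ}
    (hn : w.length = n) (hw : ∀ u a, u ++ [a] <+: w → p u a) : w ∈ stepwiseWords p n := by
  subst hn
  induction w using List.reverseRecOn with
  | nil => exact List.mem_singleton_self _
  | append_singleton w x ih =>
    rw [List.length_append, List.length_singleton, stepwiseWords, List.mem_flatMap]
    exact ⟨w, ih fun u a hu => hw u a (hu.trans (List.prefix_append w [x])),
      List.mem_map.2 ⟨x, List.mem_filter.2 ⟨List.mem_finRange x, hw w x (List.prefix_refl _)⟩, rfl⟩⟩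

theorem mem_of_pair_sublist {α : Type*} {x y : α} {u t : List α} (hn : (u ++ y :: t).Nodup)
    (h : [x, y].Sublist (u ++ y :: t)) : x ∈ u := by
  simp only [List.nodup_append', List.nodup_cons, List.disjoint_cons_right] at hn
  rcases pair_sublist_append.1 h with h | h | h
  · exact h.subset List.mem_cons_self
  · exact h.1
  · rcases List.cons_sublist_cons'.1 h with h | h
    · exact (hn.2.1.1 (h.subset (by simp))).elim
    · exact (hn.2.1.1 (List.singleton_sublist.1 h.2)).elim

/-- The words of `lltWords 8 beta3`: each letter `a < 5` comes after `a + 3`. -/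
def chainWords : List (List (Fin 8)) :=
  stepwiseWords (fun u a => !u.elem a && (decide (4 < a.val) || u.any (·.val == a.val + 3))) 8

theorem mem_chainWords {w : List (Fin 8)} (hw : w ∈ lltPart3) : w ∈ chainWords := by
  obtain ⟨hw, hx, -⟩ := mem_lltPart3.1 hw
  obtain ⟨hl, hn⟩ := mem_permWords.1 hw
  refine mem_stepwiseWords hl ?_
  rintro u a ⟨t, rfl⟩
  rw [List.append_assoc, List.singleton_append] at hn hx
  have hau : a ∉ u := fun h => (List.nodup_append'.1 hn).2.2 h List.mem_cons_self
  have hchain (ha : a.val < 5) : ∃ b ∈ u, b.val = a.val + 3 :=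
    ⟨_, mem_of_pair_sublist hn (hx ⟨a, ha⟩), rfl⟩
  simp only [List.elem_eq_mem, hau, decide_false, Bool.not_false, Bool.true_and, Bool.or_eq_true,
    decide_eq_true_eq, List.any_eq_true, beq_iff_eq]
  exact (lt_or_ge 4 a.val).imp_right fun h => hchain (Nat.lt_succ_of_le h)

/-- A recursive form of `kInv`, for evaluation. -/
def kInvRec (k : ℕ) : List (Fin N) → ℕ
  | [] => 0
  | x :: w => w.countP (fun y => y < x ∧ x.val < y.val + k) + kInvRec k w

theorem kInv_eq_kInvRec (k : ℕ) (w : List (Fin N)) : kInv k w = kInvRec k w := by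
  induction w with
  | nil => rfl
  | cons x w ih => rw [kInv_cons, kInvRec, ih]

theorem insTab_eq_of_mem_chainWords : ∀ w ∈ chainWords, kInvRec 3 w = 9 →
    (insTab w).map List.length = [2, 2, 2, 2] →
      insTab w = [[0, 1], [2, 3], [4, 5], [6, 7]] := by
  decide +kernel

theorem kInvRec_seven_ne_of_mem_chainWords : ∀ w ∈ chainWords, kInvRec 3 w = 9 →
    [0, 7].Sublist w → kInvRec 7 w ≠ 18 := by
  decide +kernel

theorem insTab_eq_of_mem_decrPairs : ∀ d < 9, ∀ w ∈ decrPairs 8 d,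
    [0, 7].Sublist w ∧ kInvRec 7 w = 18 ∧ (insTab w).map List.length = [2, 2, 2, 2] →
      insTab w = [[0, 1], [2, 3], [4, 5], [6, 7]] := by
  decide +kernel

theorem disjoint_knuthPart_lltPart3 : Disjoint knuthPart lltPart3 := by
  refine Finset.disjoint_left.2 fun w hK h3 => ?_
  obtain ⟨-, hshape, hne⟩ := mem_knuthPart.1 hK
  have hk := (mem_lltPart3.1 h3).2.2
  rw [kInv_eq_kInvRec] at hk
  exact hne (insTab_eq_of_mem_chainWords w (mem_chainWords h3) hk hshape)

theorem disjoint_lltPart3_lltPart7 : Disjoint lltPart3 lltPart7 := by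
  refine Finset.disjoint_left.2 fun w h3 h7 => ?_
  have hk3 := (mem_lltPart3.1 h3).2.2
  obtain ⟨-, h07, hk7⟩ := mem_lltPart7.1 h7
  rw [kInv_eq_kInvRec] at hk3 hk7
  exact kInvRec_seven_ne_of_mem_chainWords w (mem_chainWords h3) hk3 h07 hk7

theorem disjoint_knuthPart_lltPart7 : Disjoint knuthPart lltPart7 := by
  refine Finset.disjoint_left.2 fun w hK h7 => ?_
  obtain ⟨hw, hshape, hne⟩ := mem_knuthPart.1 hK
  obtain ⟨-, h07, hk7⟩ := mem_lltPart7.1 h7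
  have hrow : ((insTab w).headD []).length ≤ 2 := by
    cases hT : insTab w <;> simp_all
  obtain ⟨d, hd, hdw⟩ := exists_isDecrPair_of_length_insTab_le_two hrow h07
    (fun a _ => Fin.zero_le a) (fun a _ => Fin.le_last a)
  rw [(mem_permWords.1 hw).1] at hd
  rw [kInv_eq_kInvRec] at hk7
  exact hne (insTab_eq_of_mem_decrPairs d (Nat.lt_succ_of_le hd) w ((mem_decrPairs hd).2 ⟨hw, hdw⟩)
    ⟨h07, hk7, hshape⟩)

theorem balanced_Wbar : Balanced (Wbar : Set (List (Fin 8))) := by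
  have hparts : Balanced (Wstar : Set (List (Fin 8))) := by
    rw [Wstar, Finset.coe_union, Finset.coe_union]
    refine (balanced_knuthPart.union balanced_lltPart3 ?_).union balanced_lltPart7 ?_
    · exact Finset.disjoint_coe.2 disjoint_knuthPart_lltPart3
    · rw [← Finset.coe_union, Finset.disjoint_coe, Finset.disjoint_union_left]
      exact ⟨disjoint_knuthPart_lltPart7, disjoint_lltPart3_lltPart7⟩
  have hsub : Wstar ⊆ permWords 8 := fun w => by
    simp only [Wstar, Finset.mem_union, mem_knuthPart, mem_lltPart3, mem_lltPart7]
    rintro ((hw | hw) | hw) <;> exact hw.1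
  rw [Wbar, Finset.coe_sdiff]
  exact balanced_permWords.diff hparts (Finset.coe_subset.2 hsub)

end Disjointness

/-! ### The noncommutative Schur function -/

section NoncommutativeSchur

theorem ncElem_natCast (d : ℕ) :
    ncElem N d = ∑ S ∈ (Finset.univ : Finset (Fin N)).powersetCard d, mono (S.sort (· ≥ ·)) :=
  if_neg (Int.natCast_nonneg d).not_gt

theorem ncSchur_eq_of_rowLen_zero {μ : YoungDiagram} {t : ℕ} (h : μ.rowLen 0 = t) :
    ncSchur N μ = ∑ π : Equiv.Perm (Fin t), (Equiv.Perm.sign π : ℤ) • (List.ofFn fun i : Fin t =>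
      ncElem N ((μ.colLen i : ℤ) + ((π i : ℕ) : ℤ) - ((i : ℕ) : ℤ))).prod := by
  subst h
  rfl

theorem ncSchur_shape2222 :
    ncSchur N shape2222 = ncElem N 4 * ncElem N 4 - ncElem N 5 * ncElem N 3 := by
  have hrow : shape2222.rowLen 0 = 2 := by rw [YoungDiagram.rowLen_eq_card]; decide
  have hcol0 : shape2222.colLen 0 = 4 := by rw [YoungDiagram.colLen_eq_card]; decide
  have hcol1 : shape2222.colLen 1 = 4 := by rw [YoungDiagram.colLen_eq_card]; decide
  have huniv : (Finset.univ : Finset (Equiv.Perm (Fin 2))) = {1, Equiv.swap 0 1} := by decide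
  rw [ncSchur_eq_of_rowLen_zero hrow, huniv, Finset.sum_pair (by decide)]
  simp [hcol0, hcol1, List.ofFn_succ, sub_eq_add_neg]

theorem sort_toFinset_of_sortedGT {u : List (Fin N)} (hu : u.SortedGT) :
    u.toFinset.sort (· ≥ ·) = u :=
  (List.toFinset_sort (· ≥ ·) hu.nodup).2 hu.sortedGE.pairwise

open Classical in
theorem pairing_ncElem_mul_wordSum {d d' : ℕ} {W : Finset (List (Fin N))}
    (hW : ∀ w ∈ W, w.length = d + d') :
    pairing (ncElem N d * ncElem N d') (wordSum W) = (W.filter (IsDecrPair d)).card := by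
  change pairingHom _ _ = _
  rw [ncElem_natCast, ncElem_natCast, Finset.sum_mul_sum, ← Finset.sum_product', map_sum]
  simp only [mono_mul_mono, pairingHom_wordSum_mono, Set.indicator_apply, Finset.mem_coe,
    Pi.one_apply]
  rw [Finset.sum_boole, Nat.cast_inj]
  refine Finset.card_bij' (fun x _ => x.1.sort (· ≥ ·) ++ x.2.sort (· ≥ ·))
    (fun w _ => ((w.take d).toFinset, (w.drop d).toFinset)) ?_ ?_ ?_ ?_
  · rintro ⟨S, T⟩ h
    simp only [Finset.mem_filter, Finset.mem_product, Finset.mem_powersetCard] at h ⊢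
    refine ⟨h.2, ?_⟩
    rw [IsDecrPair, List.take_left' (by simp [h.1.1.2]), List.drop_left' (by simp [h.1.1.2])]
    exact ⟨Finset.sortedGT_sort S, Finset.sortedGT_sort T⟩
  · intro w hw
    obtain ⟨hw, hu, ht⟩ := Finset.mem_filter.1 hw
    have hlen := hW w hw
    simp only [Finset.mem_filter, Finset.mem_product, Finset.mem_powersetCard,
      sort_toFinset_of_sortedGT hu, sort_toFinset_of_sortedGT ht, List.take_append_drop, hw,
      List.toFinset_card_of_nodup hu.nodup, List.toFinset_card_of_nodup ht.nodup,
      List.length_take, List.length_drop, Finset.subset_univ]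
    lia
  · rintro ⟨S, T⟩ h
    simp only [Finset.mem_filter, Finset.mem_product, Finset.mem_powersetCard] at h ⊢
    rw [List.take_left' (by simp [h.1.1.2]), List.drop_left' (by simp [h.1.1.2]),
      Finset.sort_toFinset, Finset.sort_toFinset]
  · intro w hw
    obtain ⟨-, hu, ht⟩ := Finset.mem_filter.1 hw
    simp only [sort_toFinset_of_sortedGT hu, sort_toFinset_of_sortedGT ht, List.take_append_drop]

theorem isDecrPair_iff_subset_descents {d : ℕ} {w : List (Fin N)} (hd : d ≤ w.length) :
    IsDecrPair d w ↔ {j | j + 1 < w.length ∧ j + 1 ≠ d} ⊆ descents w := by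
  rw [IsDecrPair, List.sortedGT_iff_pairwise, List.sortedGT_iff_pairwise,
    ← List.isChain_iff_pairwise, ← List.isChain_iff_pairwise, List.isChain_iff_getElem,
    List.isChain_iff_getElem]
  simp only [List.getElem_take, List.getElem_drop, List.length_take, List.length_drop]
  constructor
  · rintro ⟨htake, hdrop⟩ j ⟨hj, hjd⟩
    refine ⟨hj, ?_⟩
    rcases lt_or_ge j d with h | h
    · exact htake j (by lia)
    · obtain ⟨k, rfl⟩ := Nat.exists_eq_add_of_le h
      exact hdrop k (by lia)
  · exact fun h => ⟨fun j hj => (h ⟨by lia, by lia⟩).2, fun j hj => (h ⟨by lia, by lia⟩).2⟩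

end NoncommutativeSchur

/-! ### Pairs of decreasing words in `W̄*` -/

section Counting

/-- A decision procedure for membership of a permutation in `W̄*`. -/
def wbarTest (w : List (Fin 8)) : Bool :=
  ¬ (((insTab w).map List.length = [2, 2, 2, 2] ∧ insTab w ≠ [[0, 1], [2, 3], [4, 5], [6, 7]]) ∨
    ((∀ x : Fin 5, [x.addNat 3, x.castAdd 3].Sublist w) ∧ kInvRec 3 w = 9) ∨
    [0, 7].Sublist w ∧ kInvRec 7 w = 18)

theorem mem_Wbar {w : List (Fin 8)} : w ∈ Wbar ↔ w ∈ permWords 8 ∧ wbarTest w := by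
  rw [Wbar, Wstar, Finset.mem_sdiff, Finset.mem_union, Finset.mem_union, mem_knuthPart,
    mem_lltPart3, mem_lltPart7, wbarTest, decide_eq_true_iff, kInv_eq_kInvRec, kInv_eq_kInvRec]
  exact and_congr_right fun hw => by simp only [hw, true_and, or_assoc]

theorem isStdWord_of_mem_Wbar {w : List (Fin 8)} (hw : w ∈ Wbar) : IsStdWord 8 w :=
  mem_permWords.1 (mem_Wbar.1 hw).1

open Classical in
theorem card_filter_isDecrPair_Wbar {d : ℕ} (hd : d ≤ 8) :
    (Wbar.filter (IsDecrPair d)).card = ((decrPairs 8 d).filter wbarTest).toFinset.card := by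
  refine congrArg Finset.card (Finset.ext fun w => ?_)
  rw [Finset.mem_filter, mem_Wbar, List.mem_toFinset, List.mem_filter, mem_decrPairs hd,
    and_right_comm]

open Classical in
theorem card_filter_isDecrPair_four_Wbar : (Wbar.filter (IsDecrPair 4)).card = 51 := by
  rw [card_filter_isDecrPair_Wbar (by decide)]
  decide +kernel

open Classical in
theorem card_filter_isDecrPair_five_Wbar : (Wbar.filter (IsDecrPair 5)).card = 52 := by
  rw [card_filter_isDecrPair_Wbar (by decide)]
  decide +kernel

theorem pairing_ncSchur_fstar : pairing (ncSchur 8 shape2222) fstar = -1 := by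
  classical
  have hlen : ∀ w ∈ Wbar, w.length = 8 := fun w hw => (isStdWord_of_mem_Wbar hw).1
  have h44 := pairing_ncElem_mul_wordSum (d := 4) (d' := 4) hlen
  have h53 := pairing_ncElem_mul_wordSum (d := 5) (d' := 3) hlen
  rw [card_filter_isDecrPair_four_Wbar] at h44
  rw [card_filter_isDecrPair_five_Wbar] at h53
  calc pairing (ncSchur 8 shape2222) fstar
      = pairing (ncElem 8 4 * ncElem 8 4) fstar - pairing (ncElem 8 5 * ncElem 8 3) fstar := by
        rw [ncSchur_shape2222]
        exact (pairingHom fstar).map_sub _ _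
    _ = (51 : ℕ) - (52 : ℕ) := congrArg₂ (· - ·) h44 h53
    _ = -1 := rfl

end Counting

/-! ### Schur functions as sums of fundamental quasisymmetric functions -/

section Enumeration

variable {α β : Type*} [LinearOrder β] {n : ℕ} {key : α → β}

theorem exists_equiv_strictMono_comp [Fintype α] (hn : Fintype.card α = n)
    (hkey : Function.Injective key) : ∃ e : Fin n ≃ α, StrictMono (key ∘ e) := by
  let e : Fin n ≃ α := (Fintype.equivFinOfCardEq hn).symm
  exact ⟨(Tuple.sort (key ∘ e)).trans e, (Tuple.monotone_sort (key ∘ e)).strictMono_of_injective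
    (hkey.comp ((Tuple.sort (key ∘ e)).trans e).injective)⟩

theorem equiv_eq_of_strictMono_comp {e e' : Fin n ≃ α} (he : StrictMono (key ∘ e))
    (he' : StrictMono (key ∘ e')) (hkey : Function.Injective key) : e = e' := by
  have hrange : Set.range (key ∘ e) = Set.range (key ∘ e') := by
    rw [e.surjective.range_comp, e'.surjective.range_comp]
  exact Equiv.ext fun j => hkey (congrFun ((StrictMono.range_inj he he').1 hrange) j)

end Enumeration

section Content

variable {n n' : ℕ}

/-- The exponent of the monomial `x_{s 0} ⋯ x_{s (n-1)}`. -/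
def content (s : Fin n → ℕ) : ℕ →₀ ℕ := ∑ j, Finsupp.single (s j) 1

/-- The sequences that index the monomials of `fundQuasi n D`. -/
def Compatible (n : ℕ) (D : Set ℕ) (s : Fin n → ℕ) : Prop :=
  Monotone s ∧ ∀ (j : ℕ) (h : j + 1 < n), j ∈ D → s ⟨j, Nat.lt_of_succ_lt h⟩ < s ⟨j + 1, h⟩

theorem fundQuasi_apply (n : ℕ) (D : Set ℕ) (m : ℕ →₀ ℕ) :
    fundQuasi n D m = Nat.card {s : Fin n → ℕ // Compatible n D s ∧ content s = m} := by
  simp only [fundQuasi, Compatible, content, and_assoc]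

theorem finite_content_eq (n : ℕ) (m : ℕ →₀ ℕ) : {s : Fin n → ℕ | content s = m}.Finite := by
  refine (Set.Finite.pi' fun _ : Fin n => m.support.finite_toSet).subset ?_
  rintro s rfl j
  rw [Finset.mem_coe, Finsupp.mem_support_iff, content, Finsupp.finsetSum_apply]
  exact fun h => by simpa using Finset.sum_eq_zero_iff.1 h j (Finset.mem_univ j)

theorem toMultiset_content (s : Fin n → ℕ) :
    Finsupp.toMultiset (content s) = (List.ofFn s : Multiset ℕ) := by
  rw [content, map_sum, ← Fin.univ_val_map]
  simp only [Finsupp.toMultiset_single, one_smul]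
  exact (congrArg Multiset.sum (Multiset.map_map _ _ _)).symm.trans (Multiset.sum_map_singleton _)

theorem eq_of_content_eq {s s' : Fin n → ℕ} (hs : Monotone s) (hs' : Monotone s')
    (h : content s = content s') : s = s' := by
  have hperm := congrArg Finsupp.toMultiset h
  rw [toMultiset_content, toMultiset_content, Multiset.coe_eq_coe] at hperm
  exact List.ofFn_injective (hperm.eq_of_sortedLE hs.sortedLE_ofFn hs'.sortedLE_ofFn)

theorem length_eq_of_content_eq {s : Fin n → ℕ} {s' : Fin n' → ℕ} (h : content s = content s') :
    n = n' := by
  have hcard := congrArg (fun m => Multiset.card (Finsupp.toMultiset m)) h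
  simpa only [toMultiset_content, Multiset.coe_card, List.length_ofFn] using hcard

end Content

section StandardTableaux

variable {μ : YoungDiagram} {n : ℕ}

/-- Standard tableaux of shape `μ`, as the enumerations of its cells in the order of the
entries. -/
def StdTab (μ : YoungDiagram) (n : ℕ) : Type :=
  {p : Fin n ≃ μ.cells // ∀ i j, (p i).1 ≤ (p j).1 → i ≤ j}

instance : Finite (StdTab μ n) :=
  inferInstanceAs (Finite {p : Fin n ≃ μ.cells // ∀ i j, (p i).1 ≤ (p j).1 → i ≤ j})

instance : Fintype (StdTab μ n) := Fintype.ofFinite _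

/-- The cell of the `j`-th smallest entry, as a pair `(row, column)`. -/
def StdTab.cell (p : StdTab μ n) (j : Fin n) : ℕ × ℕ := (p.1 j).1

theorem StdTab.cell_mem (p : StdTab μ n) (j : Fin n) : p.cell j ∈ μ := (p.1 j).2

theorem StdTab.cell_injective (p : StdTab μ n) : Function.Injective p.cell :=
  Subtype.val_injective.comp p.1.injective

theorem StdTab.le_of_cell_le (p : StdTab μ n) {i j : Fin n} (h : p.cell i ≤ p.cell j) : i ≤ j :=
  p.2 i j h

theorem StdTab.exists_cell_eq (p : StdTab μ n) {z : ℕ × ℕ} (hz : z ∈ μ) : ∃ j, p.cell j = z := by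
  obtain ⟨j, hj⟩ := p.1.surjective ⟨z, hz⟩
  exact ⟨j, congrArg Subtype.val hj⟩

/-- The descents of a standard tableau: the next cell is weakly to the left. -/
def StdTab.descents (p : StdTab μ n) : Set ℕ :=
  {j | ∃ h : j + 1 < n, (p.cell ⟨j + 1, h⟩).2 ≤ (p.cell ⟨j, Nat.lt_of_succ_lt h⟩).2}

theorem StdTab.col_lt_col_of_compatible (p : StdTab μ n) {s : Fin n → ℕ}
    (hs : Compatible n p.descents s) {a b : Fin n} (hab : a < b) (h : s a = s b) :
    (p.cell a).2 < (p.cell b).2 := by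
  obtain ⟨a, ha⟩ := a
  obtain ⟨b, hb⟩ := b
  have hsucc {j : ℕ} (hj : j + 1 < n) (hsj : s ⟨j, Nat.lt_of_succ_lt hj⟩ = s ⟨j + 1, hj⟩) :
      (p.cell ⟨j, Nat.lt_of_succ_lt hj⟩).2 < (p.cell ⟨j + 1, hj⟩).2 :=
    lt_of_not_ge fun hc => (hs.2 j hj ⟨hj, hc⟩).ne hsj
  induction b, Fin.mk_lt_mk.1 hab using Nat.le_induction with
  | base => exact hsucc hb h
  | succ b hab' ih =>
    have hab_le : s ⟨a, ha⟩ ≤ s ⟨b, Nat.lt_of_succ_lt hb⟩ :=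
      hs.1 (Fin.mk_le_mk.2 (Nat.le_of_succ_le hab'))
    have hb_le : s ⟨b, Nat.lt_of_succ_lt hb⟩ ≤ s ⟨b + 1, hb⟩ := hs.1 (Fin.mk_le_mk.2 b.le_succ)
    exact (ih _ (Fin.mk_lt_mk.2 hab') (hab_le.antisymm (hb_le.trans h.ge))).trans
      (hsucc hb (hb_le.antisymm (h.ge.trans hab_le)))

/-- The semistandard tableau of a standard tableau and a compatible sequence. -/
def StdTab.toSSYT (p : StdTab μ n) (s : Fin n → ℕ) (hs : Compatible n p.descents s) :
    SemistandardYoungTableau μ where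
  entry r c := if h : (r, c) ∈ μ.cells then s (p.1.symm ⟨(r, c), h⟩) else 0
  row_weak' {r c c'} hc h := by
    have h' : (r, c) ∈ μ := μ.up_left_mem le_rfl hc.le h
    rw [dif_pos ((YoungDiagram.mem_cells _).2 h), dif_pos ((YoungDiagram.mem_cells _).2 h')]
    exact hs.1 (p.2 _ _ (by simpa using hc.le))
  col_strict' {r r' c} hr h := by
    have h' : (r, c) ∈ μ := μ.up_left_mem hr.le le_rfl h
    rw [dif_pos ((YoungDiagram.mem_cells _).2 h), dif_pos ((YoungDiagram.mem_cells _).2 h')]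
    have hle : p.1.symm ⟨(r, c), (YoungDiagram.mem_cells _).2 h'⟩ ≤
        p.1.symm ⟨(r', c), (YoungDiagram.mem_cells _).2 h⟩ := p.2 _ _ (by simpa using hr.le)
    have hne : p.1.symm ⟨(r, c), (YoungDiagram.mem_cells _).2 h'⟩ ≠
        p.1.symm ⟨(r', c), (YoungDiagram.mem_cells _).2 h⟩ := by simpa using hr.ne
    refine lt_of_le_of_ne (hs.1 hle) fun hsr => ?_
    simpa [cell] using p.col_lt_col_of_compatible hs (lt_of_le_of_ne hle hne) hsr
  zeros' h := dif_neg h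

theorem StdTab.toSSYT_cell (p : StdTab μ n) {s : Fin n → ℕ} (hs : Compatible n p.descents s)
    (j : Fin n) : p.toSSYT s hs (p.cell j).1 (p.cell j).2 = s j :=
  (dif_pos (p.1 j).2).trans (congrArg s (p.1.symm_apply_apply j))

theorem StdTab.sum_single_toSSYT (p : StdTab μ n) {s : Fin n → ℕ}
    (hs : Compatible n p.descents s) :
    ∑ z ∈ μ.cells, Finsupp.single (p.toSSYT s hs z.1 z.2) 1 = content s := by
  rw [← Finset.sum_coe_sort, ← Equiv.sum_comp p.1]
  exact Finset.sum_congr rfl fun j _ => congrArg (Finsupp.single · 1) (p.toSSYT_cell hs j)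

/-- Cells are compared by their entries, then by their columns. -/
def entryKey (T : SemistandardYoungTableau μ) (z : μ.cells) : ℕ ×ₗ ℕ :=
  toLex (T z.1.1 z.1.2, z.1.2)

theorem entryKey_injective (T : SemistandardYoungTableau μ) :
    Function.Injective (entryKey T) := by
  rintro ⟨⟨r, c⟩, hz⟩ ⟨⟨r', c'⟩, hz'⟩ h
  obtain ⟨hT : T r c = T r' c', rfl : c = c'⟩ := Prod.ext_iff.1 (toLex.injective h)
  rcases lt_trichotomy r r' with hr | rfl | hr
  · exact absurd hT (T.col_strict hr hz').ne
  · rfl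
  · exact absurd hT (T.col_strict hr hz).ne'

theorem StdTab.strictMono_entryKey (p : StdTab μ n) {s : Fin n → ℕ}
    (hs : Compatible n p.descents s) : StrictMono (entryKey (p.toSSYT s hs) ∘ p.1) := by
  intro a b hab
  refine Prod.Lex.toLex_lt_toLex.2 ?_
  change p.toSSYT s hs (p.cell a).1 (p.cell a).2 < p.toSSYT s hs (p.cell b).1 (p.cell b).2 ∨
    p.toSSYT s hs (p.cell a).1 (p.cell a).2 = p.toSSYT s hs (p.cell b).1 (p.cell b).2 ∧ _
  rw [toSSYT_cell, toSSYT_cell]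
  exact (hs.1 hab.le).lt_or_eq.imp_right fun h => ⟨h, p.col_lt_col_of_compatible hs hab h⟩

theorem StdTab.eq_of_toSSYT_eq {p p' : StdTab μ n} {s s' : Fin n → ℕ}
    {hs : Compatible n p.descents s} {hs' : Compatible n p'.descents s'}
    (h : p.toSSYT s hs = p'.toSSYT s' hs') : p = p' ∧ s = s' := by
  have hp := p.strictMono_entryKey hs
  rw [h] at hp
  obtain rfl : p = p' := Subtype.ext
    (equiv_eq_of_strictMono_comp hp (p'.strictMono_entryKey hs') (entryKey_injective _))
  exact ⟨rfl, funext fun j => by rw [← p.toSSYT_cell hs j, h, toSSYT_cell]⟩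

theorem StdTab.exists_toSSYT_eq (hn : μ.card = n) (T : SemistandardYoungTableau μ) :
    ∃ (p : StdTab μ n) (s : Fin n → ℕ) (hs : Compatible n p.descents s), p.toSSYT s hs = T := by
  obtain ⟨e, he⟩ := exists_equiv_strictMono_comp
    ((Fintype.card_coe μ.cells).trans hn) (entryKey_injective T)
  have hlt {a b : Fin n} (hab : a < b) : T (e a).1.1 (e a).1.2 < T (e b).1.1 (e b).1.2 ∨
      T (e a).1.1 (e a).1.2 = T (e b).1.1 (e b).1.2 ∧ (e a).1.2 < (e b).1.2 :=
    Prod.Lex.toLex_lt_toLex.1 (he hab)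
  let p : StdTab μ n := ⟨e, fun i j hij => by
    have hT : T (e i).1.1 (e i).1.2 ≤ T (e j).1.1 (e j).1.2 :=
      (T.row_weak_of_le hij.2 (μ.up_left_mem hij.1 le_rfl (e j).2)).trans
        (T.col_weak hij.1 (e j).2)
    refine le_of_not_gt fun hji => ?_
    rcases hlt hji with h | h
    exacts [h.not_ge hT, h.2.not_ge hij.2]⟩
  have hs : Compatible n p.descents fun j => T (e j).1.1 (e j).1.2 := by
    refine ⟨monotone_iff_forall_lt.2 fun a b hab => (hlt hab).elim le_of_lt fun h => h.1.le, ?_⟩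
    rintro j h ⟨_, hj⟩
    exact (hlt (Fin.mk_lt_mk.2 j.lt_succ_self)).resolve_right fun h' => h'.2.not_ge hj
  refine ⟨p, _, hs, SemistandardYoungTableau.ext fun r c => ?_⟩
  by_cases h : (r, c) ∈ μ
  · obtain ⟨j, hj⟩ := p.exists_cell_eq h
    have hcell : p.toSSYT _ hs (p.cell j).1 (p.cell j).2 = T (p.cell j).1 (p.cell j).2 :=
      p.toSSYT_cell hs j
    rwa [hj] at hcell
  · exact (SemistandardYoungTableau.zeros _ h).trans (SemistandardYoungTableau.zeros _ h).symm

theorem schur_eq_sum_fundQuasi (hn : μ.card = n) :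
    schur μ = ∑ p : StdTab μ n, fundQuasi n p.descents := by
  funext m
  have hfin (p : StdTab μ n) :
      Finite {s : Fin n → ℕ // Compatible n p.descents s ∧ content s = m} :=
    ((finite_content_eq n m).subset fun s hs => hs.2).to_subtype
  calc schur μ m
      = Nat.card (Σ p : StdTab μ n,
          {s : Fin n → ℕ // Compatible n p.descents s ∧ content s = m}) := by
        refine congrArg Nat.cast (Nat.card_congr (Equiv.ofBijective (fun x =>
          ⟨x.1.toSSYT x.2.1 x.2.2.1, (x.1.sum_single_toSSYT x.2.2.1).trans x.2.2.2⟩)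
          ⟨?_, ?_⟩)).symm
        · rintro ⟨p, s, hs, hm⟩ ⟨p', s', hs', hm'⟩ h
          obtain ⟨rfl, rfl⟩ :=
            StdTab.eq_of_toSSYT_eq (hs := hs) (hs' := hs') (Subtype.ext_iff.1 h)
          rfl
        · rintro ⟨T, hT⟩
          obtain ⟨p, s, hs, rfl⟩ := StdTab.exists_toSSYT_eq hn T
          exact ⟨⟨p, s, hs, (p.sum_single_toSSYT hs).symm.trans hT⟩, rfl⟩
    _ = ∑ p : StdTab μ n, fundQuasi n p.descents m := by
        simp only [Nat.card_sigma, Nat.cast_sum, fundQuasi_apply]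
    _ = (∑ p : StdTab μ n, fundQuasi n p.descents) m :=
        (map_sum (MvPowerSeries.coeff m) (fun p : StdTab μ n => fundQuasi n p.descents) _).symm

end StandardTableaux

/-! ### Counting the fundamental functions with prescribed descents -/

section DescentCount

variable {n n' : ℕ}

/-- The weakly increasing sequence starting at `0` that increases by `1` at the positions outside
`E`. -/
def stair (n : ℕ) (E : Finset ℕ) (j : Fin n) : ℕ := (Finset.range j \ E).card

theorem monotone_stair (n : ℕ) (E : Finset ℕ) : Monotone (stair n E) := fun _ _ hij =>
  Finset.card_le_card (Finset.sdiff_subset_sdiff (Finset.range_mono hij) subset_rfl)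

theorem stair_lt_stair_succ_iff {E : Finset ℕ} {j : ℕ} (h : j + 1 < n) :
    stair n E ⟨j, Nat.lt_of_succ_lt h⟩ < stair n E ⟨j + 1, h⟩ ↔ j ∉ E := by
  rw [stair, stair, Finset.range_add_one]
  by_cases hj : j ∈ E
  · simp [Finset.insert_sdiff_of_mem _ hj, hj]
  · rw [Finset.insert_sdiff_of_notMem _ hj, Finset.card_insert_of_notMem (by simp)]
    simp [hj]

open Classical in
theorem fundQuasi_content_stair {E : Finset ℕ} (hE : ∀ j ∈ E, j + 1 < n) (D : Set ℕ) :
    fundQuasi n D (content (stair n E)) = if ∀ j ∈ E, j ∉ D then 1 else 0 := by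
  have eq_stair {s : Fin n → ℕ} (hs : Compatible n D s ∧ content s = content (stair n E)) :
      s = stair n E := eq_of_content_eq hs.1.1 (monotone_stair n E) hs.2
  rw [fundQuasi_apply]
  split_ifs with h
  · have hstair : Compatible n D (stair n E) :=
      ⟨monotone_stair n E, fun j hj hD => (stair_lt_stair_succ_iff hj).2 fun hjE => h j hjE hD⟩
    have : Unique {s : Fin n → ℕ // Compatible n D s ∧ content s = content (stair n E)} :=
      ⟨⟨⟨_, hstair, rfl⟩⟩, fun s => Subtype.ext (eq_stair s.2)⟩
    rw [Nat.card_unique, Nat.cast_one]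
  · have : IsEmpty {s : Fin n → ℕ // Compatible n D s ∧ content s = content (stair n E)} := by
      refine ⟨fun ⟨s, hs⟩ => h fun j hjE hD => ?_⟩
      obtain rfl := eq_stair hs
      exact (stair_lt_stair_succ_iff (hE j hjE)).1 (hs.1.2 j (hE j hjE) hD) hjE
    rw [Nat.card_of_isEmpty, Nat.cast_zero]

theorem fundQuasi_content_of_ne (h : n' ≠ n) (D : Set ℕ) (s : Fin n → ℕ) :
    fundQuasi n' D (content s) = 0 := by
  have : IsEmpty {s' : Fin n' → ℕ // Compatible n' D s' ∧ content s' = content s} :=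
    ⟨fun s' => h (length_eq_of_content_eq s'.2.2)⟩
  rw [fundQuasi_apply, Nat.card_of_isEmpty, Nat.cast_zero]

/-- The linear functional that counts, in a sum of fundamental quasisymmetric functions of degree
`n`, the terms whose descent set contains `D`; it is obtained by inclusion–exclusion from the
coefficients of the monomials that detect which descents are absent. -/
def descentCount (n : ℕ) (D : Finset ℕ) : MvPowerSeries ℕ ℤ →ₗ[ℤ] ℤ :=
  ∑ E ∈ D.powerset, (-1 : ℤ) ^ E.card • MvPowerSeries.coeff (content (stair n E))

theorem descentCount_apply (n : ℕ) (D : Finset ℕ) (F : MvPowerSeries ℕ ℤ) :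
    descentCount n D F = ∑ E ∈ D.powerset, (-1 : ℤ) ^ E.card * F (content (stair n E)) := by
  rw [descentCount, LinearMap.sum_apply]
  rfl

open Classical in
theorem descentCount_fundQuasi {D : Finset ℕ} (hD : ∀ j ∈ D, j + 1 < n) (C : Set ℕ) :
    descentCount n D (fundQuasi n C) = if (D : Set ℕ) ⊆ C then 1 else 0 := by
  have hpow : {E ∈ D.powerset | ∀ j ∈ E, j ∉ C} = {j ∈ D | j ∉ C}.powerset := by
    ext E
    simp only [Finset.mem_filter, Finset.mem_powerset, Finset.subset_iff, ← forall_and]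
  have hempty : {j ∈ D | j ∉ C} = ∅ ↔ (D : Set ℕ) ⊆ C := by
    simp [Finset.filter_eq_empty_iff, Set.subset_def]
  calc descentCount n D (fundQuasi n C)
      = ∑ E ∈ D.powerset, if ∀ j ∈ E, j ∉ C then (-1 : ℤ) ^ E.card else 0 := by
        rw [descentCount_apply]
        refine Finset.sum_congr rfl fun E hE => ?_
        rw [fundQuasi_content_stair fun j hj => hD j (Finset.mem_powerset.1 hE hj), mul_ite,
          mul_one, mul_zero]
    _ = if (D : Set ℕ) ⊆ C then 1 else 0 := by
        rw [← Finset.sum_filter, hpow, Finset.sum_powerset_neg_one_pow_card]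
        exact if_congr hempty rfl rfl

open Classical in
theorem descentCount_sum_fundQuasi {ι : Type*} {D : Finset ℕ} (hD : ∀ j ∈ D, j + 1 < n)
    (s : Finset ι) (C : ι → Set ℕ) :
    descentCount n D (∑ i ∈ s, fundQuasi n (C i)) = (s.filter fun i => (D : Set ℕ) ⊆ C i).card := by
  rw [map_sum, Finset.sum_congr rfl fun i _ => descentCount_fundQuasi hD (C i), Finset.sum_boole]

theorem descentCount_schur_of_ne {μ : YoungDiagram} (h : μ.card ≠ n) (D : Finset ℕ) :
    descentCount n D (schur μ) = 0 := by
  rw [schur_eq_sum_fundQuasi rfl, map_sum]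
  refine Finset.sum_eq_zero fun p _ => ?_
  rw [descentCount_apply]
  exact Finset.sum_eq_zero fun E _ => by rw [fundQuasi_content_of_ne h, mul_zero]

end DescentCount

/-! ### Standard tableaux with at most one ascent -/

section AtMostOneAscent

variable {μ : YoungDiagram} {n d : ℕ}

/-- The possible descents of a word of length `n`, except the position after the first `d`
letters. -/
def descentsExcept (n d : ℕ) : Finset ℕ := {j ∈ Finset.range n | j + 1 < n ∧ j + 1 ≠ d}

theorem mem_descentsExcept {j : ℕ} : j ∈ descentsExcept n d ↔ j + 1 < n ∧ j + 1 ≠ d := by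
  rw [descentsExcept, Finset.mem_filter, Finset.mem_range]
  lia

theorem lt_of_mem_descentsExcept : ∀ j ∈ descentsExcept n d, j + 1 < n :=
  fun _ hj => (mem_descentsExcept.1 hj).1

theorem isDecrPair_iff_descentsExcept_subset {w : List (Fin N)} (hw : w.length = n) (hd : d ≤ n) :
    IsDecrPair d w ↔ (descentsExcept n d : Set ℕ) ⊆ descents w := by
  subst hw
  rw [isDecrPair_iff_subset_descents hd]
  refine iff_of_eq (congrArg (· ⊆ descents w) (Set.ext fun j => ?_))
  exact mem_descentsExcept.symm

theorem StdTab.row_le (p : StdTab μ n) (i : Fin n) : (p.cell i).1 ≤ i := by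
  suffices ∀ r c (i : Fin n), p.cell i = (r, c) → r ≤ i from this _ _ i rfl
  intro r c
  induction r with
  | zero => exact fun i _ => Nat.zero_le _
  | succ r ih =>
    intro i hi
    obtain ⟨k, hk⟩ := p.exists_cell_eq (z := (r, c))
      (μ.up_left_mem r.le_succ le_rfl (hi ▸ p.cell_mem i))
    have hki : k ≤ i := p.le_of_cell_le (by rw [hk, hi]; exact ⟨r.le_succ, le_rfl⟩)
    have hne : k ≠ i := fun h => by simp [← h, hk] at hi
    exact (ih k hk).trans_lt (Fin.lt_def.1 (lt_of_le_of_ne hki hne))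

theorem StdTab.row_lt_row (p : StdTab μ n) {i j : Fin n} (hij : i < j)
    (hcol : (p.cell i).2 = (p.cell j).2) : (p.cell i).1 < (p.cell j).1 :=
  lt_of_not_ge fun h => hij.not_ge (p.le_of_cell_le ⟨h, hcol.ge⟩)

theorem StdTab.cell_zero (p : StdTab μ n) (h : 0 < n) : p.cell ⟨0, h⟩ = (0, 0) := by
  obtain ⟨k, hk⟩ := p.exists_cell_eq (z := (0, 0))
    (μ.up_left_mem (Nat.zero_le _) (Nat.zero_le _) (p.cell_mem ⟨0, h⟩))
  have hk0 : k ≤ ⟨0, h⟩ := p.le_of_cell_le (by rw [hk]; exact ⟨Nat.zero_le _, Nat.zero_le _⟩)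
  rwa [le_antisymm hk0 (Fin.mk_le_mk.2 (Nat.zero_le _))] at hk

theorem StdTab.cell_eq_of_lt (p : StdTab μ n)
    (hp : (descentsExcept n d : Set ℕ) ⊆ p.descents) {i : ℕ} (hi : i < n) (hid : i < d) :
    p.cell ⟨i, hi⟩ = (i, 0) := by
  have hcol : ∀ i (hi : i < n), i < d → (p.cell ⟨i, hi⟩).2 = 0 := by
    intro i
    induction i with
    | zero => exact fun hi _ => by rw [p.cell_zero hi]
    | succ i ih =>
      intro hi hid
      obtain ⟨_, hle⟩ := hp (mem_descentsExcept.2 ⟨hi, hid.ne⟩)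
      rw [ih _ (Nat.lt_of_succ_lt hid)] at hle
      exact Nat.le_zero.1 hle
  induction i using Nat.strong_induction_on with
  | _ i ih =>
    refine Prod.ext ((p.row_le _).antisymm (le_of_not_gt fun hlt => ?_)) (hcol i hi hid)
    have hrow := ih _ hlt (hlt.trans hi) (hlt.trans hid)
    have hcell : p.cell ⟨(p.cell ⟨i, hi⟩).1, hlt.trans hi⟩ = p.cell ⟨i, hi⟩ := by
      rw [hrow]
      exact Prod.ext rfl (hcol i hi hid).symm
    exact hlt.ne (Fin.mk.inj_iff.1 (p.cell_injective hcell))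

/-- The order in which a standard tableau with an ascent at most after its `d`-th entry visits the
cells: first the top `d` cells of the first column, then the columns from right to left. -/
def columnKey (d : ℕ) (z : ℕ × ℕ) : ℕ ×ₗ ℕᵒᵈ ×ₗ ℕ :=
  toLex (if z.2 = 0 ∧ z.1 < d then 0 else 1, toLex (OrderDual.toDual z.2, z.1))

theorem columnKey_lt_columnKey {z z' : ℕ × ℕ} : columnKey d z < columnKey d z' ↔
    ((z.2 = 0 ∧ z.1 < d) ∧ ¬ (z'.2 = 0 ∧ z'.1 < d)) ∨
      ((z.2 = 0 ∧ z.1 < d) ↔ (z'.2 = 0 ∧ z'.1 < d)) ∧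
        (z'.2 < z.2 ∨ z.2 = z'.2 ∧ z.1 < z'.1) := by
  simp only [columnKey, Prod.Lex.toLex_lt_toLex, OrderDual.toDual_lt_toDual,
    OrderDual.toDual_inj]
  split_ifs with h h' h' <;> simp [h, h']

theorem columnKey_injective (d : ℕ) : Function.Injective (columnKey d) := fun z z' h => by
  obtain ⟨-, h⟩ := Prod.ext_iff.1 (toLex.injective h)
  obtain ⟨hcol, hrow⟩ := Prod.ext_iff.1 (toLex.injective h)
  exact Prod.ext hrow (OrderDual.toDual.injective hcol)

theorem StdTab.cell_mem_top_iff (p : StdTab μ n)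
    (hp : (descentsExcept n d : Set ℕ) ⊆ p.descents) (i : Fin n) :
    (p.cell i).2 = 0 ∧ (p.cell i).1 < d ↔ i < d := by
  refine ⟨fun ⟨hcol, hrow⟩ => ?_, fun h => by simp [p.cell_eq_of_lt hp i.2 h, h]⟩
  have hcell : p.cell ⟨(p.cell i).1, (p.row_le i).trans_lt i.2⟩ = p.cell i :=
    (p.cell_eq_of_lt hp _ hrow).trans (Prod.ext rfl hcol.symm)
  rwa [← Fin.mk.inj_iff.1 (p.cell_injective hcell)]

theorem StdTab.strictMono_columnKey (p : StdTab μ n)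
    (hp : (descentsExcept n d : Set ℕ) ⊆ p.descents) : StrictMono (columnKey d ∘ p.cell) := by
  rcases n with - | n
  · exact fun i => i.elim0
  refine Fin.strictMono_iff_lt_succ.2 fun j => columnKey_lt_columnKey.2 ?_
  rw [p.cell_mem_top_iff hp, p.cell_mem_top_iff hp, Fin.val_castSucc, Fin.val_succ]
  have hrow := p.row_lt_row j.castSucc_lt_succ
  have hcol (h : j.val + 1 ≠ d) : (p.cell j.succ).2 ≤ (p.cell j.castSucc).2 :=
    (hp (mem_descentsExcept.2 ⟨Nat.succ_lt_succ j.2, h⟩)).2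
  rcases eq_or_ne (j.val + 1) d with h | h
  · lia
  · have := (hcol h).lt_or_eq
    lia

theorem StdTab.eq_of_descentsExcept_subset {p p' : StdTab μ n}
    (hp : (descentsExcept n d : Set ℕ) ⊆ p.descents)
    (hp' : (descentsExcept n d : Set ℕ) ⊆ p'.descents) : p = p' :=
  Subtype.ext (equiv_eq_of_strictMono_comp (p.strictMono_columnKey hp)
    (p'.strictMono_columnKey hp') ((columnKey_injective d).comp Subtype.val_injective))

theorem StdTab.row_eq_of_strictMono_columnKey (p : StdTab μ n)
    (hp : StrictMono (columnKey d ∘ p.cell)) {i : ℕ} (hi : i < n)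
    (htop : (p.cell ⟨i, hi⟩).2 = 0 ∧ (p.cell ⟨i, hi⟩).1 < d) :
    (p.cell ⟨i, hi⟩).1 = i := by
  refine (p.row_le _).antisymm ?_
  induction i with
  | zero => exact Nat.zero_le _
  | succ i ih =>
    have hlt : (⟨i, Nat.lt_of_succ_lt hi⟩ : Fin n) < ⟨i + 1, hi⟩ := Fin.mk_lt_mk.2 i.lt_succ_self
    have hkey := columnKey_lt_columnKey.1 (hp hlt)
    have := ih (Nat.lt_of_succ_lt hi) (by lia)
    have := p.row_lt_row hlt (by lia)
    lia

theorem StdTab.descentsExcept_subset_of_strictMono (p : StdTab μ n)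
    (hp : StrictMono (columnKey d ∘ p.cell)) (hd : ∀ r < d, (r, 0) ∈ μ) :
    (descentsExcept n d : Set ℕ) ⊆ p.descents := by
  intro j hj
  obtain ⟨hjn, hjd⟩ := mem_descentsExcept.1 hj
  refine ⟨hjn, ?_⟩
  have hlt : (⟨j, Nat.lt_of_succ_lt hjn⟩ : Fin n) < ⟨j + 1, hjn⟩ := Fin.mk_lt_mk.2 j.lt_succ_self
  have hkey := columnKey_lt_columnKey.1 (hp hlt)
  by_contra! hcol
  have htop : (p.cell ⟨j, Nat.lt_of_succ_lt hjn⟩).2 = 0 ∧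
      (p.cell ⟨j, Nat.lt_of_succ_lt hjn⟩).1 < d := by lia
  have hrow := p.row_eq_of_strictMono_columnKey hp _ htop
  obtain ⟨k, hk⟩ := p.exists_cell_eq (hd (j + 1) (by lia))
  have hjk : (⟨j, Nat.lt_of_succ_lt hjn⟩ : Fin n) < k :=
    hp.lt_iff_lt.1 (columnKey_lt_columnKey.2 (by simp only [hk]; lia))
  have hkj : k < ⟨j + 1, hjn⟩ :=
    hp.lt_iff_lt.1 (columnKey_lt_columnKey.2 (by simp only [hk]; lia))
  exact absurd (Fin.lt_def.1 hkj) (Nat.not_lt.2 (Fin.lt_def.1 hjk))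

theorem StdTab.card_eq (p : StdTab μ n) : μ.card = n := by
  rw [YoungDiagram.card, ← Fintype.card_coe, ← Fintype.card_congr p.1, Fintype.card_fin]

theorem exists_stdTab_strictMono_columnKey (hn : μ.card = n) (h₁ : (d, 1) ∉ μ)
    (h₂ : (0, 2) ∉ μ) : ∃ p : StdTab μ n, StrictMono (columnKey d ∘ p.cell) := by
  obtain ⟨e, he⟩ := exists_equiv_strictMono_comp ((Fintype.card_coe μ.cells).trans hn)
    ((columnKey_injective d).comp Subtype.val_injective)
  refine ⟨⟨e, fun i j hij => le_of_not_gt fun hji => ?_⟩, he⟩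
  have hkey := columnKey_lt_columnKey.1 (he hji)
  have hle := Prod.le_def.1 (Subtype.coe_le_coe.2 hij)
  have hrow : ¬ (d ≤ (e j).1.1 ∧ 1 ≤ (e j).1.2) := fun h =>
    h₁ (μ.up_left_mem h.1 h.2 ((YoungDiagram.mem_cells _).1 (e j).2))
  have hcol : ¬ 2 ≤ (e j).1.2 := fun h =>
    h₂ (μ.up_left_mem (Nat.zero_le _) h ((YoungDiagram.mem_cells _).1 (e j).2))
  lia

theorem StdTab.exists_descentsExcept_subset (hdn : d < n) (hnd : n ≤ 2 * d + 1)
    (p : StdTab μ n) (hp : (descentsExcept n (d + 1) : Set ℕ) ⊆ p.descents) :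
    ∃ p' : StdTab μ n, (descentsExcept n d : Set ℕ) ⊆ p'.descents := by
  have hcol : (d, 0) ∈ μ := p.cell_eq_of_lt hp hdn d.lt_succ_self ▸ p.cell_mem ⟨d, hdn⟩
  have h₁ : (d, 1) ∉ μ := fun h => by
    have hsub : Finset.range (d + 1) ×ˢ Finset.range 2 ⊆ μ.cells := fun z hz => by
      rw [Finset.mem_product, Finset.mem_range, Finset.mem_range] at hz
      exact μ.up_left_mem (Nat.le_of_lt_succ hz.1) (Nat.le_of_lt_succ hz.2) h
    have := Finset.card_le_card hsub
    rw [Finset.card_product, Finset.card_range, Finset.card_range, ← YoungDiagram.card,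
      p.card_eq] at this
    lia
  have h₂ : (0, 2) ∉ μ := fun h => by
    obtain ⟨k, hk⟩ := p.exists_cell_eq h
    obtain ⟨j, hj⟩ := p.exists_cell_eq (μ.up_left_mem le_rfl (Nat.le_succ 1) h)
    have hjk : j ≤ k := p.le_of_cell_le (by rw [hj, hk]; exact ⟨le_rfl, Nat.le_succ 1⟩)
    have hkj : k < j := (p.strictMono_columnKey hp).lt_iff_lt.1
      (columnKey_lt_columnKey.2 (by simp [hj, hk]))
    exact hjk.not_gt hkj
  obtain ⟨p', hp'⟩ := exists_stdTab_strictMono_columnKey p.card_eq h₁ h₂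
  exact ⟨p', p'.descentsExcept_subset_of_strictMono hp' fun r hr =>
    μ.up_left_mem hr.le le_rfl hcol⟩

theorem descentCount_schur_le (hdn : d < n) (hnd : n ≤ 2 * d + 1) (μ : YoungDiagram) :
    descentCount n (descentsExcept n (d + 1)) (schur μ) ≤
      descentCount n (descentsExcept n d) (schur μ) := by
  classical
  by_cases hn : μ.card = n
  · rw [schur_eq_sum_fundQuasi hn, descentCount_sum_fundQuasi lt_of_mem_descentsExcept,
      descentCount_sum_fundQuasi lt_of_mem_descentsExcept, Nat.cast_le]
    have hone : (Finset.univ.filter fun p : StdTab μ n =>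
        (descentsExcept n (d + 1) : Set ℕ) ⊆ p.descents).card ≤ 1 :=
      Finset.card_le_one.2 fun p hp p' hp' => StdTab.eq_of_descentsExcept_subset
        (Finset.mem_filter.1 hp).2 (Finset.mem_filter.1 hp').2
    rcases Finset.eq_empty_or_nonempty (Finset.univ.filter fun p : StdTab μ n =>
        (descentsExcept n (d + 1) : Set ℕ) ⊆ p.descents) with h | ⟨p, hp⟩
    · rw [h, Finset.card_empty]
      exact Nat.zero_le _
    · obtain ⟨p', hp'⟩ := p.exists_descentsExcept_subset hdn hnd (Finset.mem_filter.1 hp).2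
      exact hone.trans (Finset.card_pos.2 ⟨p', Finset.mem_filter.2 ⟨Finset.mem_univ _, hp'⟩⟩)
  · rw [descentCount_schur_of_ne hn, descentCount_schur_of_ne hn]

theorem descentCount_le_of_schurPositive (hdn : d < n) (hnd : n ≤ 2 * d + 1)
    {F : MvPowerSeries ℕ ℤ} (hF : SchurPositive F) :
    descentCount n (descentsExcept n (d + 1)) F ≤ descentCount n (descentsExcept n d) F := by
  obtain ⟨c, rfl⟩ := hF
  simp only [Finsupp.sum, map_sum, map_smul, smul_eq_mul]
  exact Finset.sum_le_sum fun μ _ =>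
    mul_le_mul_of_nonneg_left (descentCount_schur_le hdn hnd μ) (Nat.cast_nonneg _)

open Classical in
theorem card_isDecrPair_le_of_schurPositive (hdn : d < n) (hnd : n ≤ 2 * d + 1)
    {W : Finset (List (Fin N))} (hW : ∀ w ∈ W, w.length = n)
    (hpos : SchurPositive (∑ w ∈ W, fundQuasi n (descents w))) :
    (W.filter (IsDecrPair (d + 1))).card ≤ (W.filter (IsDecrPair d)).card := by
  have hcount (d) (hd : d ≤ n) :
      descentCount n (descentsExcept n d) (∑ w ∈ W, fundQuasi n (descents w)) =
        (W.filter (IsDecrPair d)).card := by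
    rw [descentCount_sum_fundQuasi lt_of_mem_descentsExcept]
    exact congrArg _ (congrArg _ (Finset.filter_congr fun w hw =>
      (isDecrPair_iff_descentsExcept_subset (hW w hw) hd).symm))
  rw [← Nat.cast_le (α := ℤ), ← hcount _ hdn, ← hcount _ hdn.le]
  exact descentCount_le_of_schurPositive hdn hnd hpos

end AtMostOneAscent

theorem Delta_wordSum {n : ℕ} {W : Finset (List (Fin N))} (hW : ∀ w ∈ W, w.length = n) :
    Delta N (wordSum W) = ∑ w ∈ W, fundQuasi n (descents w) := by
  rw [wordSum, map_sum]
  refine Finset.sum_congr rfl fun w hw => ?_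
  change Finsupp.linearCombination ℤ _ (Finsupp.single (FreeMonoid.ofList w) (1 : ℤ)) = _
  rw [Finsupp.linearCombination_single, one_smul, ← hW w hw]
  rfl

theorem not_schurPositive_Wbar : ¬ SchurPositive (∑ w ∈ Wbar, fundQuasi 8 (descents w)) := by
  classical
  intro h
  have hle := card_isDecrPair_le_of_schurPositive (d := 4) (by norm_num) (by norm_num)
    (fun w hw => (isStdWord_of_mem_Wbar hw).1) h
  rw [card_filter_isDecrPair_four_Wbar, card_filter_isDecrPair_five_Wbar] at hle
  norm_num at hle

end DZero

end

theorem corollaryc :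
    DZero.fstar ∈ DZero.perp (DZero.idealKR 8) ∧
    DZero.pairing (DZero.ncSchur 8 DZero.shape2222) DZero.fstar = -1 ∧
    ¬ DZero.SchurPositive (DZero.Delta 8 DZero.fstar) ∧
    ∃ G : DZero.D0Graph 8 8, G.verts = DZero.Wbar ∧ ¬ DZero.SchurPositive G.genFun := by
  have hstd : ∀ w ∈ DZero.Wbar, DZero.IsStdWord 8 w := fun _ => DZero.isStdWord_of_mem_Wbar
  have hneg := DZero.not_schurPositive_Wbar
  refine ⟨DZero.wordSum_mem_perp (fun w hw => (hstd w hw).2) DZero.balanced_Wbar,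
    DZero.pairing_ncSchur_fstar, ?_, ?_⟩
  · rwa [DZero.fstar, DZero.Delta_wordSum fun w hw => (hstd w hw).1]
  · obtain ⟨G, hG⟩ := DZero.exists_d0Graph hstd DZero.balanced_Wbar
    exact ⟨G, hG, by rwa [DZero.D0Graph.genFun, hG]⟩
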